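/- **Setting.** Let $V$ be a separable Banach space, $T\in\mathbb N_0$, $I=\{0,1,\dots,T\}$ and $r\ge 0$. For $U\subseteq V$ let $\mathcal S(U)$ be the collection of adapted processes $\mathbf X=(\Omega,\mathbb P,(\mathcal F_t)_{t\in I},X)$, where $(\Omega,\mathbb P,(\mathcal F_t)_{t\in I})$ is a filtered probability space and $X_t:\Omega\to U$ is $\mathcal F_t$-measurable for every $t\in I$. *Adapted functionals.* $\mathrm{AF}$ is the smallest class of maps from $\mathcal S(U)$ to bounded random variables that contains $\mathbf X\mapsto f(X_{t_1},\dots,X_{t_n})$ for $f\in C_b(U^n,\mathbb R)$, and with $f_1,\dots,f_n$ also $\mathbf X\mapsto g(f_1(\mathbf X),\dots,f_n(\mathbf X))$ for $g\in C_b(\mathbb R^n,\mathbb R)$, and with $f$ also $\mathbf X\mapsto\mathbb E[f(\mathbf X)\mid\mathcal F_t]$ for $t\in I$. $\mathrm{AF}_r$ consists of those with a construction in which at most $r$ conditional expectations are nested. The adapted topology $\tau_r$ on $\mathcal S(U)$ is the coarsest one for which $\mathbf X\mapsto\mathbb E[f(\mathbf X)]$ is continuous for all $f\in\mathrm{AF}_r$.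 *Prediction processes.* Put $\mathrm{Prob}_0(U)=U$ and $\mathrm{Prob}_{k+1}(U)=\mathrm{Prob}(I\to\mathrm{Prob}_k(U))$ (Borel probability measures with the weak topology). Let $\hat X^0=X$ and $\hat X^{k+1}_t=\mathbb P(\hat X^k\in\cdot\mid\mathcal F_t)$ (regular conditional distributions), so that $\mathrm{Law}(\hat X^k)\in\mathrm{Prob}_{k+1}(U)$. The extended weak topology $\hat\tau_r$ on $\mathcal S(U)$ is the initial topology of $\mathbf X\mapsto\mathrm{Law}(\hat X^r)$. *Signatures.* For every normed space $W$ that occurs below fix norms on the algebraic tensor powers $W^{\otimes m}$, $m\ge0$, that are admissible, i.e. $\|v_1\otimes\dots\otimes v_m\|\le\prod_i\|v_i\|$, $\|s\otimes t\|\le\|s\|\|t\|$ for $s\in W^{\otimes m}$, $t\in W^{\otimes n}$, and $|(\ell_1\otimes\dots\otimes\ell_m)(t)|\le\prod_i\|\ell_i\|\,\|t\|$ for $\ell_i\in W^*$ (for example the projective or the injective norms). Let $\mathbf T(W)$ be the completion of $\bigoplus_{m\ge0}W^{\otimes m}$ under $\|t\|=\sum_m\|t_m\|$, and put $\mathbf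 T^0(V)=V$, $\mathbf T^{k+1}(V)=\mathbf T(\mathbb R\oplus\mathbf T^k(V))$, where $\|(s,w)\|=|s|+\|w\|$ on $\mathbb R\oplus W$. The signature of $x:I\to W$ is $$S(x)=\exp(\Delta_0x)\cdot\exp(\Delta_1x)\cdots\exp(\Delta_Tx)\in\mathbf T(\mathbb R\oplus W),\qquad \Delta_0x=(1,x(0)),\quad \Delta_tx=(1,x(t)-x(t-1)),$$ with $\exp(v)=(v^{\otimes m}/m!)_{m\ge0}$ and the tensor convolution product. A tensor normalization of $\mathbf T(W)$ is a bounded, continuous, injective map $\Lambda:\{t\in\mathbf T(W):t_0=1\}\to\mathbf T(W)$ of the form $\Lambda(t)=(\lambda(t)^mt_m)_{m\ge0}$ with $\lambda(t)>0$. Fix tensor normalizations for all spaces that occur; the robust signature is $\Lambda\circ S$. For $F=\Lambda\circ S$ (robust) or $F=S$ (classical) define $\bar F^0(x)=x$ and $$\bar F^{k+1}(\mu)=\int F\big(t\mapsto\bar F^k(x(t))\big)\,\mu(dx)\in\mathbf T^{k+1}(V),\qquad \mu\in\mathrm{Prob}_{k+1}(U),$$ and $\Phi_r(\mathbf X)=\bar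 F^{r+1}(\mathrm{Law}(\hat X^r))$, $d_r(\mathbf X,\mathbf Y)=\|\Phi_r(\mathbf X)-\Phi_r(\mathbf Y)\|$. **Theorem.** For every choice of admissible norms and of tensor normalizations the following holds. 1. Let $\Phi_r$ and $d_r$ be defined with the robust signature. For $\mathbf X,\mathbf Y\in\mathcal S(V)$, $$\mathbb E[f(\mathbf X)]=\mathbb E[f(\mathbf Y)]\ \text{ for all } f\in\mathrm{AF}_r\quad\Longleftrightarrow\quad\Phi_r(\mathbf X)=\Phi_r(\mathbf Y).$$ 2. With the same $\Phi_r$ and $d_r$: $\Phi_r$ locally induces $\tau_r$ and $d_r$ locally metrizes $\tau_r$. That is, on every subset $\mathcal K$ of $\mathcal S(V)$ that is compact for $\hat\tau_r$, the following topologies coincide: the one induced by $\tau_r$, the initial topology of $\Phi_r|_{\mathcal K}$, the topology of the semimetric $d_r|_{\mathcal K\times\mathcal K}$, and the one induced by $\hat\tau_r$. 3. If $K\subset V$ is compact, the statements hold on $\mathcal S(K)$ without localization, with the robust signature as well as with the classical signature in the definition of $\Phi_r$ and $d_r$: for $\mathbf X,\mathbf Y\in\mathcal S(K)$ the equivalence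 in 1 holds, and the topologies $\tau_r$, $\hat\tau_r$, the initial topology of $\Phi_r$ and the topology of the semimetric $d_r$ on $\mathcal S(K)$ are equal. -/

import Mathlib

open MeasureTheory Topology
open scoped TensorProduct BoundedContinuousFunction

universe u w

noncomputable section

namespace AdaptedSig

/-! ### Adapted processes and adapted functionals -/

/-- An adapted stochastic process indexed by `I = {0, …, T}` with state space `U`: a filtered
probability space together with a process such that `X t` is `ℱ t`-measurable for each `t`. -/
structure AdaptedProcess (T : ℕ) (U : Type u) [MeasurableSpace U] where
  Ω : Type w
  mΩ : MeasurableSpace Ω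
  P : Measure Ω
  isProb : IsProbabilityMeasure P
  ℱ : Filtration (Fin (T + 1)) mΩ
  X : Fin (T + 1) → Ω → U
  adapted : ∀ t, Measurable[ℱ t] (X t)

attribute [instance] AdaptedProcess.mΩ AdaptedProcess.isProb

/-- Constructions of adapted functionals: bounded continuous functions of finitely many marginals,
bounded continuous functions of finitely many adapted functionals, conditional expectations. -/
inductive AdaptedFunctional (T : ℕ) (U : Type u) [TopologicalSpace U] : Type u
  | marginal {n : ℕ} (t : Fin n → Fin (T + 1)) (f : (Fin n → U) →ᵇ ℝ) : AdaptedFunctional T U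
  | comp {n : ℕ} (g : (Fin n → ℝ) →ᵇ ℝ) (f : Fin n → AdaptedFunctional T U) :
      AdaptedFunctional T U
  | condExp (t : Fin (T + 1)) (f : AdaptedFunctional T U) : AdaptedFunctional T U

/-- The number of nested conditional expectations. -/
def AdaptedFunctional.rank {T : ℕ} {U : Type u} [TopologicalSpace U] :
    AdaptedFunctional T U → ℕ
  | .marginal _ _ => 0
  | .comp _ f => Finset.univ.sup fun i => (f i).rank
  | .condExp _ f => f.rank + 1

/-- The random variable `f(𝐗)` (a version of it, as conditional expectations are only defined
almost surely). -/
def AdaptedFunctional.eval {T : ℕ} {U : Type u} [TopologicalSpace U] [MeasurableSpace U]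
    (X : AdaptedProcess.{u, w} T U) : AdaptedFunctional T U → X.Ω → ℝ
  | .marginal t f => fun ω => f fun i => X.X (t i) ω
  | .comp g f => fun ω => g fun i => (f i).eval X ω
  | .condExp t f => MeasureTheory.condExp (X.ℱ t) X.P (f.eval X)

/-- `E[f(𝐗)]`. -/
def AdaptedFunctional.expect {T : ℕ} {U : Type u} [TopologicalSpace U] [MeasurableSpace U]
    (f : AdaptedFunctional T U) (X : AdaptedProcess.{u, w} T U) : ℝ :=
  ∫ ω, f.eval X ω ∂X.P

/-- `AF_r`, the adapted functionals of rank at most `r`. -/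
def AF (T : ℕ) (U : Type u) [TopologicalSpace U] (r : ℕ) : Set (AdaptedFunctional T U) :=
  {f | f.rank ≤ r}

/-- The adapted topology `τ_r`: the coarsest topology on processes making `𝐗 ↦ E[f(𝐗)]`
continuous for all `f ∈ AF_r`. -/
@[reducible] def tau (T : ℕ) (U : Type u) [TopologicalSpace U] [MeasurableSpace U] (r : ℕ) :
    TopologicalSpace (AdaptedProcess.{u, w} T U) :=
  ⨅ f ∈ AF T U r, TopologicalSpace.induced (fun X => f.expect X) inferInstance

/-! ### Measures of rank `r` and prediction processes -/

/-- A topological space with its Borel σ-algebra. -/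
structure BorelSp : Type (u + 1) where
  carrier : Type u
  [top : TopologicalSpace carrier]
  [meas : MeasurableSpace carrier]
  [borel : BorelSpace carrier]

attribute [instance] BorelSp.top BorelSp.meas BorelSp.borel

/-- The paths `I → X`, with the product topology. -/
def BorelSp.path (T : ℕ) (X : BorelSp.{u}) : BorelSp.{u} where
  carrier := Fin (T + 1) → X.carrier
  top := Pi.topologicalSpace
  meas := _root_.borel _
  borel := @BorelSpace.mk _ _ (_root_.borel _) rfl

/-- The Borel probability measures on `X`, with the topology of weak convergence. -/
def BorelSp.prob (X : BorelSp.{u}) : BorelSp.{u} where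
  carrier := ProbabilityMeasure X.carrier
  meas := _root_.borel _
  borel := @BorelSpace.mk _ _ (_root_.borel _) rfl

/-- The underlying measure of a point of `X.prob`. -/
def BorelSp.measureOf {X : BorelSp.{u}} (μ : X.prob.carrier) : Measure X.carrier :=
  ProbabilityMeasure.toMeasure (Ω := X.carrier) μ

/-- The rank `r` probability measures: `Prob_0 = U`, `Prob_{r+1} = Prob(I → Prob_r)`. -/
def probRank (T : ℕ) (U : BorelSp.{u}) : ℕ → BorelSp.{u}
  | 0 => U
  | r + 1 => ((probRank T U r).path T).prob

section Prediction

variable {T : ℕ} {U : Type u} [MeasurableSpace U]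

/-- `Y` is (a version of) the prediction process `Y_t = P(Z ∈ · | ℱ_t)` of the random variable `Z`:
`Y_t` is a regular conditional distribution of `Z` given `ℱ_t`. -/
structure IsPrediction (X : AdaptedProcess.{u, w} T U) {A : BorelSp.{u}} (Z : X.Ω → A.carrier)
    (Y : X.Ω → (A.prob.path T).carrier) : Prop where
  measurable : Measurable Y
  adapted : ∀ t, Measurable[X.ℱ t] fun ω => Y ω t
  condLaw : ∀ t, ∀ B : Set A.carrier, MeasurableSet B →
    (fun ω => (BorelSp.measureOf (Y ω t)).real B)
      =ᵐ[X.P] MeasureTheory.condExp (X.ℱ t) X.P ((Z ⁻¹' B).indicator fun _ => (1 : ℝ))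

open Classical in
/-- The prediction process of `Z`, in a chosen version. The last value is never used when `A` is
Polish, since regular conditional distributions then exist. -/
def predict (X : AdaptedProcess.{u, w} T U) {A : BorelSp.{u}}
    (Z : {Z : X.Ω → A.carrier // Measurable Z}) :
    {Y : X.Ω → (A.prob.path T).carrier // Measurable Y} :=
  if h : ∃ Y, IsPrediction X Z.1 Y then ⟨h.choose, h.choose_spec.measurable⟩
  else ⟨fun _ _ => (⟨Measure.dirac (Z.1 X.P.nonempty_of_neZero.some),
    Measure.dirac.isProbabilityMeasure⟩ : ProbabilityMeasure A.carrier), measurable_const⟩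

variable [TopologicalSpace U] [SecondCountableTopology U] [BorelSpace U]

/-- The state space as a bundled Borel space. -/
def BorelSp.of (U : Type u) [TopologicalSpace U] [MeasurableSpace U] [BorelSpace U] :
    BorelSp.{u} where
  carrier := U

theorem AdaptedProcess.measurable_path (X : AdaptedProcess.{u, w} T U) :
    @Measurable X.Ω ((BorelSp.of U).path T).carrier X.mΩ ((BorelSp.of U).path T).meas
      fun ω t => X.X t ω := by
  have h : Measurable fun ω => (fun t => X.X t ω : Fin (T + 1) → U) :=
    measurable_pi_lambda _ fun t => (X.adapted t).mono (X.ℱ.le t) le_rfl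
  have e : (MeasurableSpace.pi : MeasurableSpace (Fin (T + 1) → U)) = borel _ :=
    BorelSpace.measurable_eq
  rw [e] at h
  exact h

/-- The rank `r` prediction process `X̂^r`, as a random path in `Prob_r(U)`:
`X̂^0 = X` and `X̂^{r+1}_t = P(X̂^r ∈ · | ℱ_t)`. -/
def AdaptedProcess.prediction (X : AdaptedProcess.{u, w} T U) : (r : ℕ) →
    {Z : X.Ω → ((probRank T (BorelSp.of U) r).path T).carrier // Measurable Z}
  | 0 => ⟨fun ω t => X.X t ω, X.measurable_path⟩
  | r + 1 => predict X (X.prediction r)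

/-- `Law(X̂^r) ∈ Prob_{r+1}(U) = Prob(I → Prob_r(U))`. -/
def AdaptedProcess.lawPrediction (X : AdaptedProcess.{u, w} T U) (r : ℕ) :
    (probRank T (BorelSp.of U) (r + 1)).carrier :=
  (⟨X.P.map (X.prediction r).1,
    Measure.isProbabilityMeasure_map (X.prediction r).2.aemeasurable⟩ :
    ProbabilityMeasure ((probRank T (BorelSp.of U) r).path T).carrier)

end Prediction

/-- The extended weak topology `τ̂_r`: weak convergence of the laws of the rank `r` prediction
processes. -/
@[reducible] def tauHat (T : ℕ) (U : Type u) [TopologicalSpace U] [SecondCountableTopology U]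
    [MeasurableSpace U] [BorelSpace U] (r : ℕ) : TopologicalSpace (AdaptedProcess.{u, w} T U) :=
  TopologicalSpace.induced (fun X => X.lawPrediction r) inferInstance

/-! ### Tensor norms and the completed tensor algebra -/

/-- The tensor product `W^{⊗m} × W^{⊗n} → W^{⊗(m+n)}`. -/
def tpMul {W : Type u} [AddCommGroup W] [Module ℝ W] {m n : ℕ} (s : ⨂[ℝ]^m W) (t : ⨂[ℝ]^n W) :
    ⨂[ℝ]^(m + n) W :=
  GradedMonoid.GMul.mul (A := fun i => ⨂[ℝ]^i W) s t

/-- The unit `1 ∈ W^{⊗0} = ℝ`. -/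
def tpOne (W : Type u) [AddCommGroup W] [Module ℝ W] : ⨂[ℝ]^0 W :=
  GradedMonoid.GOne.one (A := fun i => ⨂[ℝ]^i W)

/-- Admissible norms on the tensor powers of `W`: on each `W^{⊗m}` a reasonable crossnorm, and
submultiplicative across degrees. Together `tprod_le` and `dual_le` give
`‖v₁ ⊗ ⋯ ⊗ vₘ‖ = ∏ ‖vᵢ‖` (so the norms are permutation invariant on elementary tensors), and
`dual_le` makes the seminorms norms. The projective and the injective norms are examples. -/
structure AdmissibleNorm (W : Type u) [NormedAddCommGroup W] [NormedSpace ℝ W] where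
  nrm : ∀ m : ℕ, Seminorm ℝ (⨂[ℝ]^m W)
  tprod_le : ∀ (m : ℕ) (v : Fin m → W), nrm m (PiTensorProduct.tprod ℝ v) ≤ ∏ i, ‖v i‖
  mul_le : ∀ (m n : ℕ) (s : ⨂[ℝ]^m W) (t : ⨂[ℝ]^n W),
    nrm (m + n) (tpMul s t) ≤ nrm m s * nrm n t
  dual_le : ∀ (m : ℕ) (ℓ : Fin m → (W →L[ℝ] ℝ)) (t : ⨂[ℝ]^m W),
    |PiTensorProduct.lift ((MultilinearMap.mkPiAlgebra ℝ (Fin m) ℝ).compLinearMap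
      fun i => (ℓ i : W →ₗ[ℝ] ℝ)) t| ≤ (∏ i, ‖ℓ i‖) * nrm m t

section TensorAlgebra

variable {W : Type u} [NormedAddCommGroup W] [NormedSpace ℝ W]

/-- `W^{⊗m}` with the norm chosen by `α`. -/
def TPow (_α : AdmissibleNorm W) (m : ℕ) : Type u := ⨂[ℝ]^m W

instance (α : AdmissibleNorm W) (m : ℕ) : AddCommGroup (TPow α m) :=
  inferInstanceAs (AddCommGroup (⨂[ℝ]^m W))

instance (α : AdmissibleNorm W) (m : ℕ) : Module ℝ (TPow α m) :=
  inferInstanceAs (Module ℝ (⨂[ℝ]^m W))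

instance (α : AdmissibleNorm W) (m : ℕ) : SeminormedAddCommGroup (TPow α m) :=
  AddGroupSeminorm.toSeminormedAddCommGroup (E := TPow α m) (α.nrm m).toAddGroupSeminorm

instance (α : AdmissibleNorm W) (m : ℕ) : NormedSpace ℝ (TPow α m) where
  norm_smul_le c t := ((α.nrm m).smul' c t).le

/-- The embedding of `W^{⊗m}` into its completion. -/
def TPow.toCompletion (α : AdmissibleNorm W) (m : ℕ) (t : ⨂[ℝ]^m W) :
    UniformSpace.Completion (TPow α m) :=
  UniformSpace.Completion.coe' (α := TPow α m) t

theorem TPow.norm_toCompletion (α : AdmissibleNorm W) (m : ℕ) (t : ⨂[ℝ]^m W) :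
    ‖TPow.toCompletion α m t‖ = α.nrm m t :=
  UniformSpace.Completion.norm_coe (E := TPow α m) t

/-- The completion of `⨁_m W^{⊗m}` under the norm `∑_m ‖π_m t‖`, realized as the space of sequences
`t = (t_m)` with `t_m` in the completion of `W^{⊗m}` and `∑_m ‖t_m‖ < ∞`. -/
abbrev TAlg (α : AdmissibleNorm W) : Type u :=
  lp (fun m : ℕ => UniformSpace.Completion (TPow α m)) 1

/-- Formal series of tensors, `∏_m W^{⊗m}`. -/
abbrev TSeries (W : Type u) [NormedAddCommGroup W] [NormedSpace ℝ W] : Type u :=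
  ∀ m : ℕ, ⨂[ℝ]^m W

/-- The unit `(1, 0, 0, …)`. -/
def tone : TSeries W := Pi.single 0 (tpOne W)

/-- The tensor convolution product, `(s · t)_m = ∑_{i ≤ m} s_i ⊗ t_{m-i}`. -/
def tmul (s t : TSeries W) : TSeries W := fun m =>
  ∑ i : Fin (m + 1), TensorPower.cast ℝ W (Nat.add_sub_of_le (Nat.le_of_lt_succ i.2))
    (tpMul (s i) (t (m - i)))

/-- The tensor exponential `v ↦ (v^{⊗m} / m!)_m`. -/
def texp (v : W) : TSeries W := fun m =>
  ((Nat.factorial m : ℝ)⁻¹) • PiTensorProduct.tprod ℝ fun _ : Fin m => v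

/-- `ℝ ⊕ W` with the norm `|s| + ‖w‖`. -/
abbrev Aug (W : Type u) : Type u := WithLp 1 (ℝ × W)

/-- The time-augmented increments `Δ_0 x = (1, x(0))`, `Δ_t x = (1, x(t) - x(t-1))`. -/
def incr {T : ℕ} (x : Fin (T + 1) → W) (t : Fin (T + 1)) : Aug W :=
  WithLp.toLp 1 (1, Fin.cases (x 0) (fun s : Fin T => x s.succ - x s.castSucc) t)

/-- The ordered product `∏_{t ∈ I} exp(Δ_t x)` as a formal series. -/
def sigSeries {T : ℕ} (x : Fin (T + 1) → W) : TSeries (Aug W) :=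
  (List.ofFn fun t => texp (incr x t)).foldr tmul tone

theorem AdmissibleNorm.nrm_cast (α : AdmissibleNorm W) {i j : ℕ} (h : i = j) (a : ⨂[ℝ]^i W) :
    α.nrm j (TensorPower.cast ℝ W h a) = α.nrm i a := by
  subst h
  rw [TensorPower.cast_refl, LinearEquiv.refl_apply]

theorem summable_tone (α : AdmissibleNorm W) : Summable fun m => α.nrm m (tone (W := W) m) := by
  refine summable_of_ne_finset_zero (s := {0}) fun m hm => ?_
  rw [tone, Pi.single_eq_of_ne (by simpa using hm), map_zero]

theorem summable_texp (α : AdmissibleNorm W) (v : W) :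
    Summable fun m => α.nrm m (texp v m) := by
  refine Summable.of_nonneg_of_le (fun m => apply_nonneg _ _) (fun m => ?_)
    (Real.summable_pow_div_factorial ‖v‖)
  rw [texp, map_smul_eq_mul, Real.norm_of_nonneg (by positivity), div_eq_inv_mul]
  refine mul_le_mul_of_nonneg_left ((α.tprod_le m _).trans ?_) (by positivity)
  simp

theorem summable_tmul (α : AdmissibleNorm W) {s t : TSeries W}
    (hs : Summable fun m => α.nrm m (s m)) (ht : Summable fun m => α.nrm m (t m)) :
    Summable fun m => α.nrm m (tmul s t m) := by
  have key := (summable_norm_sum_mul_range_of_summable_norm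
    (f := fun m => α.nrm m (s m)) (g := fun m => α.nrm m (t m)) hs.norm ht.norm)
  refine Summable.of_nonneg_of_le (fun m => apply_nonneg _ _) (fun m => ?_) key
  refine le_trans ?_ (le_abs_self _)
  rw [← Fin.sum_univ_eq_sum_range (fun i => α.nrm i (s i) * α.nrm (m - i) (t (m - i)))]
  refine (Finset.le_sum_of_subadditive (α.nrm m) (map_zero _).le (map_add_le_add _) _ _).trans ?_
  refine Finset.sum_le_sum fun i _ => ?_
  rw [α.nrm_cast]
  exact α.mul_le _ _ _ _

theorem summable_sigSeries {T : ℕ} (α : AdmissibleNorm (Aug W)) (x : Fin (T + 1) → W) :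
    Summable fun m => α.nrm m (sigSeries x m) := by
  unfold sigSeries
  generalize hL : List.ofFn (fun t => texp (incr x t)) = L
  have hmem : ∀ s ∈ L, Summable fun m => α.nrm m (s m) := by
    intro s hs
    rw [← hL, List.mem_ofFn] at hs
    obtain ⟨t, rfl⟩ := hs
    exact summable_texp α _
  clear hL
  induction L with
  | nil => exact summable_tone α
  | cons s L ih =>
    exact summable_tmul α (hmem s (by simp)) (ih fun s' h => hmem s' (by simp [h]))

/-- The classical (discrete time, time-augmented) signature `S(x) = ∏_{t ∈ I} exp(Δ_t x)`. -/
def signature {T : ℕ} (α : AdmissibleNorm (Aug W)) (x : Fin (T + 1) → W) : TAlg α :=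
  ⟨fun m => TPow.toCompletion α m (sigSeries x m), by
    refine memℓp_gen ?_
    simp only [ENNReal.toReal_one, Real.rpow_one, TPow.norm_toCompletion]
    exact summable_sigSeries α x⟩

/-- The series with constant term `1`. -/
def unital (α : AdmissibleNorm W) : Set (TAlg α) :=
  {t | t 0 = TPow.toCompletion α 0 (tpOne W)}

/-- A tensor normalization: a bounded, continuous, injective map of the form
`t ↦ δ_{λ(t)} t = (λ(t)^m t_m)_m`, with `λ(t) > 0`, on the series with constant term `1`. -/
structure TensorNormalization (α : AdmissibleNorm W) where
  toFun : TAlg α → TAlg α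
  lam : TAlg α → ℝ
  lam_pos : ∀ t ∈ unital α, 0 < lam t
  apply_eq : ∀ t ∈ unital α, ∀ m : ℕ, toFun t m = lam t ^ m • t m
  continuousOn : ContinuousOn toFun (unital α)
  injOn : Set.InjOn toFun (unital α)
  bounded : ∃ C : ℝ, ∀ t ∈ unital α, ‖toFun t‖ ≤ C

end TensorAlgebra

/-! ### Higher rank tensor algebras and expected signatures -/

/-- A choice of admissible tensor norms for all normed spaces. -/
abbrev TensorNorms : Type (u + 1) :=
  ∀ (W : Type u) [NormedAddCommGroup W] [NormedSpace ℝ W], AdmissibleNorm W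

/-- A choice of tensor normalizations for all normed spaces. -/
abbrev TensorNormalizations (α : TensorNorms.{u}) : Type (u + 1) :=
  ∀ (W : Type u) [NormedAddCommGroup W] [NormedSpace ℝ W], TensorNormalization (α W)

/-- A bundled real normed space. -/
structure NormedSp : Type (u + 1) where
  carrier : Type u
  [grp : NormedAddCommGroup carrier]
  [spc : NormedSpace ℝ carrier]

attribute [instance] NormedSp.grp NormedSp.spc

/-- The rank `r` tensor algebra: `T^0(V) = V`, and `T^{r+1}(V)` is the completion of
`⨁_m (ℝ ⊕ T^r(V))^{⊗m}`. -/
def TRank (α : TensorNorms.{u}) (V : Type u) [NormedAddCommGroup V] [NormedSpace ℝ V] :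
    ℕ → NormedSp.{u}
  | 0 => ⟨V⟩
  | r + 1 => ⟨TAlg (α (Aug (TRank α V r).carrier))⟩

/-- Maps that send paths `I → W` in any normed space `W` to the completed tensor algebra over
`ℝ ⊕ W`. -/
abbrev PathFeature (α : TensorNorms.{u}) (T : ℕ) : Type (u + 1) :=
  ∀ (W : Type u) [NormedAddCommGroup W] [NormedSpace ℝ W], (Fin (T + 1) → W) → TAlg (α (Aug W))

/-- The classical signature `S`. -/
def classicalSig (α : TensorNorms.{u}) (T : ℕ) : PathFeature α T :=
  fun W _ _ x => signature (α (Aug W)) x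

/-- The robust signature `Λ ∘ S`. -/
def robustSig (α : TensorNorms.{u}) (Λ : TensorNormalizations α) (T : ℕ) : PathFeature α T :=
  fun W _ _ x => (Λ (Aug W)).toFun (signature (α (Aug W)) x)

/-- The rank `r` expected signature `Prob_r(U) → T^r(V)` built from the signature `F`, for a state
space `U` embedded in `V` by `ι`: the embedding for `r = 0`, and
`μ ↦ ∫ F(t ↦ expSig_r (x t)) μ(dx)` for `r + 1`. -/
def expSig {α : TensorNorms.{u}} {T : ℕ} (F : PathFeature α T) {U : Type u} [TopologicalSpace U]
    [MeasurableSpace U] [BorelSpace U] {V : Type u} [NormedAddCommGroup V] [NormedSpace ℝ V]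
    (ι : U → V) : (r : ℕ) → (probRank T (BorelSp.of U) r).carrier → (TRank α V r).carrier
  | 0 => ι
  | r + 1 => fun μ => ∫ x : ((probRank T (BorelSp.of U) r).path T).carrier,
      F (TRank α V r).carrier (fun t => expSig F ι r (x t)) ∂BorelSp.measureOf μ

section Phi

variable {α : TensorNorms.{u}} {T : ℕ} (F : PathFeature α T) {U : Type u} [TopologicalSpace U]
  [SecondCountableTopology U] [MeasurableSpace U] [BorelSpace U] {V : Type u}
  [NormedAddCommGroup V] [NormedSpace ℝ V] (ι : U → V) (r : ℕ)

/-- `Φ_r(𝐗)`, the rank `r + 1` expected signature of `Law(X̂^r)`. -/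
def Phi (X : AdaptedProcess.{u, w} T U) : (TRank α V (r + 1)).carrier :=
  expSig F ι (r + 1) (X.lawPrediction r)

/-- The semimetric `d_r(𝐗, 𝐘) = ‖Φ_r(𝐗) - Φ_r(𝐘)‖`. -/
def sigDist (X Y : AdaptedProcess.{u, w} T U) : ℝ :=
  ‖Phi F ι r X - Phi F ι r Y‖

end Phi

/-- The topology of a semimetric `d`: a set is open iff with each of its points it contains a
`d`-ball around it. -/
@[reducible] def semimetricTopology {E : Type*} (d : E → E → ℝ) : TopologicalSpace E where
  IsOpen s := ∀ x ∈ s, ∃ ε > 0, ∀ y, d x y < ε → y ∈ s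
  isOpen_univ := fun _ _ => ⟨1, one_pos, fun _ _ => trivial⟩
  isOpen_inter := fun s t hs ht x hx => by
    obtain ⟨ε, hε, h⟩ := hs x hx.1
    obtain ⟨δ, hδ, h'⟩ := ht x hx.2
    exact ⟨min ε δ, lt_min hε hδ, fun y hy =>
      ⟨h y (hy.trans_le (min_le_left _ _)), h' y (hy.trans_le (min_le_right _ _))⟩⟩
  isOpen_sUnion := fun S hS x hx => by
    obtain ⟨s, hs, hxs⟩ := hx
    obtain ⟨ε, hε, h⟩ := hS s hs x hxs
    exact ⟨ε, hε, fun y hy => ⟨s, hs, h y hy⟩⟩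

end AdaptedSig

end

noncomputable section

namespace AdaptedSig

open Filter Set
open scoped ENNReal NNReal

/-!
Both sides of the theorem are functions of the law of the prediction process `X̂^r`, an element of
the Polish space `Prob_{r+1}(U)`, and both are continuous and injective there. On a compact set a
continuous injection into a Hausdorff space is an embedding, so that all the topologies agree.

For the adapted functionals of rank `r`, each `E[f(𝐗)]` is the integral of a bounded continuous
function against the law of `X̂^r`. The functions that occur form an algebra; by induction on `r` it
separates points, and hence determines probability measures.

For `Φ_r`, the signature is group-like, so that its coordinates span an algebra by the shuffle
identity, and they separate paths. Hence the expectation of a bounded signature is injective on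
probability measures. Iterating this along the ranks gives the injectivity of the expected signature
of rank `r + 1`. Boundedness comes from the tensor normalization or from the compactness of the
state space.
-/

/-! ### Probability measures on separable metrizable and Polish spaces -/

section ProbabilityMeasure

theorem isInducing_probabilityMeasure_map {X Y : Type*} [TopologicalSpace X]
    [TopologicalSpace.PseudoMetrizableSpace X] [MeasurableSpace X] [BorelSpace X]
    [TopologicalSpace Y] [TopologicalSpace.MetrizableSpace Y] [TopologicalSpace.SeparableSpace Y]
    [MeasurableSpace Y] [BorelSpace Y] {j : X → Y} (hj : IsInducing j) :
    IsInducing fun μ : ProbabilityMeasure X => μ.map hj.continuous.measurable.aemeasurable := by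
  refine isInducing_iff_nhds.2 fun μ => le_antisymm
    (map_le_iff_le_comap.1 ((ProbabilityMeasure.continuous_map hj.continuous).tendsto μ))
    (tendsto_id'.1 (tendsto_of_forall_isOpen_le_liminf' fun _ hpre => ?_))
  obtain ⟨G, hG, rfl⟩ := hj.isOpen_iff.1 hpre
  have map_apply (ν : ProbabilityMeasure X) :
      (ν.map hj.continuous.measurable.aemeasurable : Measure Y) G = (ν : Measure X) (j ⁻¹' G) := by
    rw [ProbabilityMeasure.toMeasure_map,
      Measure.map_apply hj.continuous.measurable hG.measurableSet]
  have key := ProbabilityMeasure.le_liminf_measure_open_of_tendsto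
    (tendsto_comap (f := fun μ : ProbabilityMeasure X =>
      μ.map hj.continuous.measurable.aemeasurable)
      (x := 𝓝 (μ.map hj.continuous.measurable.aemeasurable))) hG
  simpa only [map_apply, id] using key

instance secondCountableTopology_probabilityMeasure {X : Type*} [TopologicalSpace X]
    [TopologicalSpace.MetrizableSpace X] [TopologicalSpace.SeparableSpace X] [MeasurableSpace X]
    [BorelSpace X] : SecondCountableTopology (ProbabilityMeasure X) := by
  let := TopologicalSpace.metrizableSpaceMetric X
  obtain ⟨F, hF⟩ := Metric.PiNatEmbed.exists_embedding_to_hilbert_cube (X := X)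
  have : SecondCountableTopology (ProbabilityMeasure (ℕ → unitInterval)) := by
    let := TopologicalSpace.metrizableSpaceMetric (ProbabilityMeasure (ℕ → unitInterval))
    infer_instance
  exact (isInducing_probabilityMeasure_map hF.isInducing).secondCountableTopology

theorem measure_compl_thickening_le_of_levyProkhorovEDist_lt {X : Type*} [PseudoEMetricSpace X]
    [MeasurableSpace X] [OpensMeasurableSpace X] {μ ν : Measure X} {c : ℝ≥0∞}
    (h : levyProkhorovEDist μ ν < c) (s : Set X) :
    ν (Metric.thickening c.toReal s)ᶜ ≤ μ sᶜ + c :=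
  (right_measure_le_of_levyProkhorovEDist_lt h
    Metric.isOpen_thickening.measurableSet.compl).trans <|
    add_le_add_left (measure_mono (Metric.thickening_compl_thickening_self_subset_compl _ s)) c

theorem isCompact_iInter_cthickening {X : Type*} [MetricSpace X] [CompleteSpace X] {K : ℕ → Set X}
    (hK : ∀ m, IsCompact (K m)) :
    IsCompact (⋂ m : ℕ, Metric.cthickening (1 / ((m : ℝ) + 1)) (K m)) := by
  refine TotallyBounded.isCompact_of_isClosed (Metric.totallyBounded_iff.2 fun r hr => ?_)
    (isClosed_iInter fun m => Metric.isClosed_cthickening)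
  obtain ⟨m, hm⟩ := exists_nat_one_div_lt (half_pos hr)
  obtain ⟨t, ht, htK⟩ := Metric.totallyBounded_iff.1 (hK m).totallyBounded (r / 2) (half_pos hr)
  refine ⟨t, ht, fun x hx => ?_⟩
  obtain ⟨z, hz, hxz⟩ := Metric.mem_thickening_iff.1
    (Metric.cthickening_subset_thickening' (half_pos hr) hm (K m) (mem_iInter.1 hx m))
  obtain ⟨y, hy, hzy⟩ := mem_iUnion₂.1 (htK hz)
  refine mem_iUnion₂.2 ⟨y, hy, Metric.mem_ball.2 ?_⟩
  linarith [dist_triangle x z y, Metric.mem_ball.1 hzy]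

theorem isTightMeasureSet_of_forall_thickening {X : Type*} [MetricSpace X] [CompleteSpace X]
    [MeasurableSpace X] {S : Set (Measure X)}
    (hS : ∀ δ > 0, ∀ ε > 0, ∃ K : Set X, IsCompact K ∧
      ∀ μ ∈ S, μ (Metric.thickening δ K)ᶜ ≤ ε) :
    IsTightMeasureSet S := by
  refine isTightMeasureSet_iff_exists_isCompact_measure_compl_le.2 fun ε hε => ?_
  obtain ⟨δ, hδ, hδε⟩ := ENNReal.exists_pos_sum_of_countable' hε.ne' ℕ
  choose K hK hKS using fun m : ℕ => hS (1 / ((m : ℝ) + 1)) (by positivity) (δ m) (hδ m)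
  refine ⟨_, isCompact_iInter_cthickening hK, fun μ hμ => ?_⟩
  rw [compl_iInter]
  calc μ (⋃ m : ℕ, (Metric.cthickening (1 / ((m : ℝ) + 1)) (K m))ᶜ)
      ≤ ∑' m : ℕ, μ (Metric.cthickening (1 / ((m : ℝ) + 1)) (K m))ᶜ := measure_iUnion_le _
    _ ≤ ∑' m, δ m := ENNReal.tsum_le_tsum fun m =>
        (measure_mono (compl_subset_compl.2 (Metric.thickening_subset_cthickening _ _))).trans
          (hKS m μ hμ)
    _ ≤ ε := hδε.le

theorem exists_isCompact_forall_le_measure_compl_le {X : Type*} [TopologicalSpace X]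
    [PolishSpace X] [MeasurableSpace X] [BorelSpace X] (μ : ℕ → Measure X)
    [∀ i, IsFiniteMeasure (μ i)] (N : ℕ) {ε : ℝ≥0∞} (hε : 0 < ε) :
    ∃ K : Set X, IsCompact K ∧ ∀ i ≤ N, μ i Kᶜ ≤ ε := by
  choose C hC hCμ using fun i => isTightMeasureSet_iff_exists_isCompact_measure_compl_le.1
    (isTightMeasureSet_singleton (μ := μ i)) ε hε
  exact ⟨⋃ i ∈ Iic N, C i, (finite_Iic N).isCompact_biUnion fun i _ => hC i, fun i hi =>
    (measure_mono (compl_subset_compl.2 (subset_biUnion_of_mem (u := C) (mem_Iic.2 hi)))).trans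
      (hCμ i _ rfl)⟩

theorem isTightMeasureSet_range_of_cauchySeq {X : Type*} [MetricSpace X] [CompleteSpace X]
    [SecondCountableTopology X] [MeasurableSpace X] [BorelSpace X]
    {μ : ℕ → LevyProkhorov (ProbabilityMeasure X)} (hμ : CauchySeq μ) :
    IsTightMeasureSet
      {((ν : ProbabilityMeasure X) : Measure X) | ν ∈ range fun n => (μ n).toMeasure} := by
  refine isTightMeasureSet_of_forall_thickening fun δ hδ ε hε => ?_
  obtain ⟨η, hη, hηδ, hηε⟩ : ∃ η : ℝ≥0, 0 < η ∧ (η : ℝ) ≤ δ ∧ (η : ℝ≥0∞) < ε / 2 := by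
    obtain ⟨η, hη, hηε⟩ := ENNReal.lt_iff_exists_nnreal_btwn.1 (ENNReal.half_pos hε.ne')
    exact ⟨min η ⟨δ, hδ.le⟩, lt_min (by exact_mod_cast hη) hδ, min_le_right _ _,
      lt_of_le_of_lt (by exact_mod_cast min_le_left _ _) hηε⟩
  obtain ⟨N, hN⟩ := EMetric.cauchySeq_iff'.1 hμ η (by exact_mod_cast hη)
  obtain ⟨K, hK, hKN⟩ := exists_isCompact_forall_le_measure_compl_le
    (fun i => ((μ i).toMeasure : Measure X)) N (ENNReal.half_pos hε.ne')
  refine ⟨K, hK, ?_⟩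
  rintro _ ⟨_, ⟨n, rfl⟩, rfl⟩
  rcases le_total n N with hn | hn
  · exact (measure_mono (compl_subset_compl.2 (Metric.self_subset_thickening hδ K))).trans
      ((hKN n hn).trans ENNReal.half_le_self)
  · have hdist : levyProkhorovEDist ((μ N).toMeasure : Measure X) ((μ n).toMeasure : Measure X) < η
        := by
      rw [← LevyProkhorov.edist_probabilityMeasure_def, edist_comm]
      exact hN n hn
    calc ((μ n).toMeasure : Measure X) (Metric.thickening δ K)ᶜ
        ≤ ((μ n).toMeasure : Measure X) (Metric.thickening η K)ᶜ :=
          measure_mono (compl_subset_compl.2 (Metric.thickening_mono hηδ K))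
      _ ≤ ((μ N).toMeasure : Measure X) Kᶜ + η :=
          measure_compl_thickening_le_of_levyProkhorovEDist_lt hdist K
      _ ≤ ε / 2 + ε / 2 := add_le_add (hKN N le_rfl) hηε.le
      _ = ε := ENNReal.add_halves ε

instance polishSpace_probabilityMeasure {X : Type*} [TopologicalSpace X] [PolishSpace X]
    [MeasurableSpace X] [BorelSpace X] : PolishSpace (ProbabilityMeasure X) := by
  let := TopologicalSpace.upgradeIsCompletelyMetrizable X
  let e := LevyProkhorov.probabilityMeasureHomeomorph (Ω := X)
  have : SecondCountableTopology (LevyProkhorov (ProbabilityMeasure X)) :=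
    e.symm.isInducing.secondCountableTopology
  have : CompleteSpace (LevyProkhorov (ProbabilityMeasure X)) := by
    refine Metric.complete_of_cauchySeq_tendsto fun μ hμ => ?_
    have hcompact :=
      isCompact_closure_of_isTightMeasureSet (isTightMeasureSet_range_of_cauchySeq hμ)
    obtain ⟨ν, -, hν⟩ := cauchySeq_tendsto_of_isComplete (hcompact.image e.continuous).isComplete
      (u := μ) (fun n => ⟨_, subset_closure ⟨n, rfl⟩, rfl⟩) hμ
    exact ⟨ν, hν⟩
  exact e.isClosedEmbedding.polishSpace

theorem borel_eq_iSup_comap {ι X : Type*} {Y : ι → Type*} [tX : TopologicalSpace X]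
    [SecondCountableTopology X] [tY : ∀ i, TopologicalSpace (Y i)] {f : ∀ i, X → Y i}
    (h : tX = ⨅ i, (tY i).induced (f i)) : borel X = ⨆ i, (borel (Y i)).comap (f i) := by
  have hsub : tX = TopologicalSpace.generateFrom
      (⋃ i, {s | IsOpen[(tY i).induced (f i)] s}) := by
    rw [generateFrom_iUnion]
    exact h.trans (iInf_congr fun i => (TopologicalSpace.generateFrom_setOfPred_isOpen _).symm)
  have hcomap (i : ι) : (borel (Y i)).comap (f i) =
      MeasurableSpace.generateFrom {s | IsOpen[(tY i).induced (f i)] s} := borel_comap.symm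
  rw [borel_eq_generateFrom_of_subbasis hsub, iSup_congr hcomap, MeasurableSpace.iSup_generateFrom]

theorem probabilityMeasure_eq_iInf_induced_integral {X : Type*} [TopologicalSpace X]
    [MeasurableSpace X] [OpensMeasurableSpace X] :
    (inferInstance : TopologicalSpace (ProbabilityMeasure X)) =
      ⨅ f : X →ᵇ ℝ, TopologicalSpace.induced
        (fun μ : ProbabilityMeasure X => ∫ x, f x ∂(μ : Measure X)) inferInstance := by
  refine le_antisymm (le_iInf fun f => continuous_iff_le_induced.1
    (ProbabilityMeasure.continuous_integral_boundedContinuousFunction f)) ?_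
  rw [← continuous_id_iff_le]
  refine (@ProbabilityMeasure.continuous_iff_forall_continuous_integral _ _ _ _ _
    (_) id).2 fun f => ?_
  exact continuous_iff_le_induced.2 (iInf_le _ f)

theorem stronglyMeasurable_integral_probabilityMeasure {X E : Type*} [MeasurableSpace X]
    [NormedAddCommGroup E] [NormedSpace ℝ E] {f : X → E} (hf : StronglyMeasurable f) :
    StronglyMeasurable fun μ : ProbabilityMeasure X => ∫ x, f x ∂(μ : Measure X) :=
  let toKernel : ProbabilityTheory.Kernel (ProbabilityMeasure X) X :=
    ⟨fun μ => (μ : Measure X), measurable_subtype_coe⟩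
  hf.integral_kernel (κ := toKernel)

instance borelSpace_probabilityMeasure {X : Type*} [TopologicalSpace X]
    [TopologicalSpace.MetrizableSpace X] [TopologicalSpace.SeparableSpace X] [MeasurableSpace X]
    [BorelSpace X] : BorelSpace (ProbabilityMeasure X) := by
  refine ⟨le_antisymm (measurable_iff_comap_le.1 ?_) ?_⟩
  · let : MeasurableSpace (ProbabilityMeasure X) := borel _
    have : BorelSpace (ProbabilityMeasure X) := ⟨rfl⟩
    refine Measurable.measure_of_isPiSystem_of_isProbabilityMeasure
      (μ := fun μ : ProbabilityMeasure X => (μ : Measure X))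
      (BorelSpace.measurable_eq (α := X)) isPiSystem_isOpen fun G hG => ?_
    exact LowerSemicontinuous.measurable fun μ y hy => eventually_lt_of_lt_liminf
      (hy.trans_le (ProbabilityMeasure.le_liminf_measure_open_of_tendsto tendsto_id hG))
  · rw [borel_eq_iSup_comap probabilityMeasure_eq_iInf_induced_integral]
    refine iSup_le fun f => measurable_iff_comap_le.1 ?_
    rw [← BorelSpace.measurable_eq (α := ℝ)]
    exact (stronglyMeasurable_integral_probabilityMeasure
      f.continuous.stronglyMeasurable).measurable

end ProbabilityMeasure
section WeakContinuity

variable {X E : Type*} [TopologicalSpace X] [MeasurableSpace X] [BorelSpace X]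
  [NormedAddCommGroup E]

theorem integrable_boundedContinuousFunction [TopologicalSpace.PseudoMetrizableSpace X]
    [SecondCountableTopologyEither X E] (μ : Measure X) [IsFiniteMeasure μ] (h : X →ᵇ E) :
    Integrable h μ :=
  .of_bound h.continuous.aestronglyMeasurable ‖h‖ (ae_of_all _ h.norm_coe_le_norm)

variable [NormedSpace ℝ E]

theorem exists_eLpNorm_smul_sub_indicator_const_le [NormalSpace X] (μ : Measure X)
    [IsFiniteMeasure μ] [μ.WeaklyRegular] (c : E) {s : Set X} (hs : MeasurableSet s) {ε : ℝ≥0∞}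
    (hε : ε ≠ 0) :
    ∃ φ : X →ᵇ ℝ, eLpNorm ((fun x => φ x • c) - s.indicator fun _ => c) 1 μ ≤ ε := by
  have hind : MemLp (s.indicator fun _ => (1 : ℝ)) 1 μ := memLp_indicator_const 1 hs 1 (by simp)
  obtain ⟨φ, hφ, -⟩ := hind.exists_boundedContinuous_eLpNorm_sub_le ENNReal.one_ne_top
    (ENNReal.div_pos hε (ENNReal.coe_ne_top (r := ‖c‖₊))).ne'
  refine ⟨φ, (eLpNorm_le_nnreal_smul_eLpNorm_of_ae_le_mul (c := ‖c‖₊)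
    (g := (s.indicator fun _ => (1 : ℝ)) - ⇑φ) (ae_of_all _ fun x => ?_) 1).trans ?_⟩
  · have : φ x • c - s.indicator (fun _ => c) x =
        -((s.indicator (fun _ => (1 : ℝ)) x - φ x) • c) := by
      by_cases hx : x ∈ s <;> simp [hx, sub_smul]
    simp only [Pi.sub_apply, this, nnnorm_neg, nnnorm_smul, mul_comm, le_refl]
  · rw [ENNReal.smul_def, smul_eq_mul]
    exact (mul_le_mul_right hφ _).trans ENNReal.mul_div_le

theorem exists_boundedContinuousFunction_integral_norm_sub_le
    [TopologicalSpace.PseudoMetrizableSpace X] [SecondCountableTopologyEither X E]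
    [CompleteSpace E] (μ : Measure X) [IsFiniteMeasure μ] {f : X → E} (hf : Integrable f μ)
    {ε : ℝ} (hε : 0 < ε) :
    ∃ h : X →ᵇ E, ∫ x, ‖f x - h x‖ ∂μ ≤ ε ∧
      Continuous fun ν : ProbabilityMeasure X => ∫ x, h x ∂(ν : Measure X) := by
  let P (g : X → E) : Prop := ∃ h : X →ᵇ E, ⇑h = g ∧
    Continuous fun ν : ProbabilityMeasure X => ∫ x, h x ∂(ν : Measure X)
  have exists_near_indicator (c : E) ⦃s : Set X⦄ (hs : MeasurableSet s) (_ : μ s < ∞) {δ : ℝ≥0∞}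
      (hδ : δ ≠ 0) : ∃ g : X → E, eLpNorm (g - s.indicator fun _ => c) 1 μ ≤ δ ∧ P g := by
    obtain ⟨φ, hφ⟩ := exists_eLpNorm_smul_sub_indicator_const_le μ c hs hδ
    refine ⟨_, hφ, φ • BoundedContinuousFunction.const X c, rfl, ?_⟩
    change Continuous fun ν : ProbabilityMeasure X => ∫ x, φ x • c ∂(ν : Measure X)
    simp only [integral_smul_const]
    exact
      (ProbabilityMeasure.continuous_integral_boundedContinuousFunction φ).smul continuous_const
  have add_mem (g h : X → E) : P g → P h → P (g + h) := by
    rintro ⟨g, rfl, hg⟩ ⟨h, rfl, hh⟩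
    refine ⟨g + h, rfl, ?_⟩
    simp only [BoundedContinuousFunction.add_apply,
      integral_add (integrable_boundedContinuousFunction _ g)
        (integrable_boundedContinuousFunction _ h)]
    exact hg.add hh
  have aestronglyMeasurable (g : X → E) : P g → AEStronglyMeasurable g μ := by
    rintro ⟨h, rfl, -⟩
    exact h.continuous.aestronglyMeasurable
  obtain ⟨_, hfh, h, rfl, hh⟩ := (memLp_one_iff_integrable.2 hf).induction_dense ENNReal.one_ne_top
    P exists_near_indicator add_mem aestronglyMeasurable (ENNReal.ofReal_pos.2 hε).ne'
  refine ⟨h, ?_, hh⟩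
  have hint : Integrable (f - ⇑h) μ := hf.sub (integrable_boundedContinuousFunction μ h)
  rw [← ENNReal.ofReal_le_ofReal_iff hε.le]
  exact (ofReal_integral_norm_eq_lintegral_enorm hint).trans_le
    (eLpNorm_one_eq_lintegral_enorm.symm.trans_le hfh)

theorem continuous_integral_boundedContinuousFunction [TopologicalSpace.PseudoMetrizableSpace X]
    [SecondCountableTopologyEither X E] [CompleteSpace E] (G : X →ᵇ E) :
    Continuous fun μ : ProbabilityMeasure X => ∫ x, G x ∂(μ : Measure X) := by
  refine continuous_iff_continuousAt.2 fun μ => Metric.continuousAt_iff'.2 fun ε hε => ?_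
  have integrable (ν : ProbabilityMeasure X) (h : X →ᵇ E) :=
    integrable_boundedContinuousFunction (ν : Measure X) h
  obtain ⟨h, hGh, hcont⟩ := exists_boundedContinuousFunction_integral_norm_sub_le (μ : Measure X)
    (integrable μ G) (show (0 : ℝ) < ε / 4 by positivity)
  have hGh_cont : Continuous fun ν : ProbabilityMeasure X => ∫ x, ‖G x - h x‖ ∂(ν : Measure X) :=
    ProbabilityMeasure.continuous_integral_boundedContinuousFunction (G - h).normComp
  have dist_integral_le (ν : ProbabilityMeasure X) :
      dist (∫ x, G x ∂(ν : Measure X)) (∫ x, h x ∂(ν : Measure X)) ≤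
        ∫ x, ‖G x - h x‖ ∂(ν : Measure X) := by
    rw [dist_eq_norm, ← integral_sub (integrable ν G) (integrable ν h)]
    exact norm_integral_le_integral_norm _
  filter_upwards [hGh_cont.continuousAt.eventually_lt continuousAt_const
      (show _ < ε / 2 by linarith), Metric.continuousAt_iff'.1 hcont.continuousAt (ε / 4)
      (by positivity)] with ν hν hνh
  calc dist (∫ x, G x ∂(ν : Measure X)) (∫ x, G x ∂(μ : Measure X))
      ≤ dist (∫ x, G x ∂(ν : Measure X)) (∫ x, h x ∂(ν : Measure X)) +
          dist (∫ x, h x ∂(ν : Measure X)) (∫ x, h x ∂(μ : Measure X)) +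
          dist (∫ x, h x ∂(μ : Measure X)) (∫ x, G x ∂(μ : Measure X)) := dist_triangle4 _ _ _ _
    _ < ε / 2 + ε / 4 + ε / 4 := add_lt_add_of_lt_of_le
        (add_lt_add ((dist_integral_le ν).trans_lt hν) hνh)
        ((dist_comm _ _).trans_le ((dist_integral_le μ).trans hGh))
    _ = ε := by ring

theorem isClosedEmbedding_diracProba [TopologicalSpace.MetrizableSpace X]
    [SecondCountableTopology X] :
    IsClosedEmbedding (diracProba : X → ProbabilityMeasure X) := by
  refine ⟨isEmbedding_diracProba, isClosed_of_closure_subset fun μ hμ => ?_⟩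
  obtain ⟨u, hu, hlim⟩ := mem_closure_iff_seq_limit.1 hμ
  choose x hx using hu
  obtain rfl : (fun n => diracProba (x n)) = u := funext hx
  obtain ⟨a, ha⟩ := (μ : Measure X).nonempty_support (IsProbabilityMeasure.ne_zero _)
  have hxa : Tendsto x atTop (𝓝 a) := (nhds_basis_opens a).tendsto_right_iff.2 fun U hU => by
    have hpos := ((Measure.mem_support_iff_forall a).1 ha U (hU.2.mem_nhds hU.1)).trans_le
      (ProbabilityMeasure.le_liminf_measure_open_of_tendsto hlim hU.2)
    filter_upwards [eventually_lt_of_lt_liminf hpos] with n hn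
    by_contra hxU
    simp [diracProba, Measure.dirac_apply' _ hU.2.measurableSet, hxU] at hn
  exact ⟨a, tendsto_nhds_unique ((continuous_diracProba.tendsto a).comp hxa) hlim⟩

end WeakContinuity

/-! ### Initial topologies and semimetrics -/

theorem induced_comp_eq_of_isCompact {S Y Z : Type*} [TopologicalSpace Y] [TopologicalSpace Z]
    [T2Space Z] {L : S → Y} {q : Y → Z} (hq : Continuous q) (hinj : Function.Injective q)
    {C : Set Y} (hC : IsCompact C) (hL : ∀ s, L s ∈ C) :
    TopologicalSpace.induced (fun s => q (L s)) inferInstance =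
      TopologicalSpace.induced L inferInstance := by
  have : CompactSpace C := isCompact_iff_compactSpace.1 hC
  have hrestrict : IsInducing (C.domRestrict q) :=
    ((hq.comp continuous_subtype_val).isClosedEmbedding
      (hinj.comp Subtype.val_injective)).isInducing
  let L' : S → C := fun s => ⟨L s, hL s⟩
  calc TopologicalSpace.induced (C.domRestrict q ∘ L') inferInstance
      = TopologicalSpace.induced L' inferInstance := by
        rw [← induced_compose, ← hrestrict.eq_induced]
    _ = TopologicalSpace.induced (Subtype.val ∘ L') inferInstance := induced_compose

theorem semimetricTopology_norm_sub {E F : Type*} [SeminormedAddCommGroup F] (Φ : E → F) :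
    semimetricTopology (fun X Y => ‖Φ X - Φ Y‖) = TopologicalSpace.induced Φ inferInstance := by
  refine TopologicalSpace.ext_iff.2 fun s => ?_
  rw [@isOpen_iff_mem_nhds E (TopologicalSpace.induced Φ inferInstance) s]
  refine forall₂_congr fun x _ => ?_
  rw [nhds_induced, Metric.nhds_basis_ball.comap Φ |>.mem_iff]
  refine exists_congr fun ε => and_congr_right fun _ => forall_congr' fun y => ?_
  rw [mem_preimage, Metric.mem_ball, dist_comm, dist_eq_norm]

/-! ### The Borel spaces of higher rank measures -/

section BorelSp

variable {T : ℕ} {A : BorelSp.{u}}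

theorem BorelSp.continuous_eval (t : Fin (T + 1)) :
    Continuous fun x : (A.path T).carrier => (x t : A.carrier) :=
  continuous_apply (A := fun _ : Fin (T + 1) => A.carrier) t

instance BorelSp.polishSpace_path [PolishSpace A.carrier] : PolishSpace (A.path T).carrier :=
  inferInstanceAs (PolishSpace (Fin (T + 1) → A.carrier))

instance BorelSp.polishSpace_prob [PolishSpace A.carrier] : PolishSpace A.prob.carrier :=
  inferInstanceAs (PolishSpace (ProbabilityMeasure A.carrier))

instance BorelSp.compactSpace_path [CompactSpace A.carrier] : CompactSpace (A.path T).carrier :=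
  inferInstanceAs (CompactSpace (Fin (T + 1) → A.carrier))

instance BorelSp.compactSpace_prob [PolishSpace A.carrier] [CompactSpace A.carrier] :
    CompactSpace A.prob.carrier :=
  inferInstanceAs (CompactSpace (ProbabilityMeasure A.carrier))

instance BorelSp.polishSpace_of {U : Type u} [TopologicalSpace U] [MeasurableSpace U]
    [BorelSpace U] [PolishSpace U] : PolishSpace (BorelSp.of U).carrier :=
  inferInstanceAs (PolishSpace U)

instance polishSpace_probRank [PolishSpace A.carrier] :
    ∀ k, PolishSpace (probRank T A k).carrier
  | 0 => inferInstanceAs (PolishSpace A.carrier)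
  | k + 1 =>
    have := polishSpace_probRank k
    inferInstanceAs (PolishSpace ((probRank T A k).path T).prob.carrier)

theorem compactSpace_probRank [PolishSpace A.carrier] [CompactSpace A.carrier] :
    ∀ k, CompactSpace (probRank T A k).carrier
  | 0 => inferInstanceAs (CompactSpace A.carrier)
  | k + 1 =>
    have := compactSpace_probRank k
    inferInstanceAs (CompactSpace ((probRank T A k).path T).prob.carrier)

instance BorelSp.isProbabilityMeasure_measureOf (μ : A.prob.carrier) :
    IsProbabilityMeasure (BorelSp.measureOf μ) :=
  Subtype.property (p := fun ν : Measure A.carrier => IsProbabilityMeasure ν) μ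

theorem BorelSp.measureOf_injective :
    Function.Injective (BorelSp.measureOf : A.prob.carrier → Measure A.carrier) :=
  ProbabilityMeasure.toMeasure_injective

theorem BorelSp.norm_integral_le_norm (φ : A.carrier →ᵇ ℝ) (μ : A.prob.carrier) :
    ‖∫ x, φ x ∂BorelSp.measureOf μ‖ ≤ ‖φ‖ := by
  simpa using norm_integral_le_of_norm_le_const (μ := BorelSp.measureOf μ)
    (ae_of_all _ fun x => φ.norm_coe_le_norm x)

theorem BorelSp.continuous_integral (φ : A.carrier →ᵇ ℝ) :
    Continuous fun μ : A.prob.carrier => ∫ x, φ x ∂BorelSp.measureOf μ :=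
  ProbabilityMeasure.continuous_integral_boundedContinuousFunction φ

variable {E : Type*} [MeasurableSpace E]

theorem BorelSp.measurable_path [SecondCountableTopology A.carrier] {f : E → (A.path T).carrier}
    (h : ∀ t, Measurable fun e => (f e t : A.carrier)) : Measurable f := by
  have hpi : Measurable (fun e t => f e t : E → Fin (T + 1) → A.carrier) :=
    measurable_pi_lambda _ h
  rwa [BorelSpace.measurable_eq (α := Fin (T + 1) → A.carrier)] at hpi

theorem BorelSp.measurable_prob_iff [TopologicalSpace.MetrizableSpace A.carrier]
    [SecondCountableTopology A.carrier] {f : E → A.prob.carrier} :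
    Measurable f ↔ Measurable fun e => BorelSp.measureOf (f e) := by
  change Measurable[_, _root_.borel (ProbabilityMeasure A.carrier)] f ↔ _
  rw [← BorelSpace.measurable_eq (α := ProbabilityMeasure A.carrier)]
  exact ⟨measurable_subtype_coe.comp, fun h => h.subtype_mk⟩

end BorelSp

/-! ### Prediction processes -/

theorem exists_regular_conditional_distribution {Ω A : Type*} {m mΩ : MeasurableSpace Ω}
    (hm : m ≤ mΩ) (P : Measure Ω) [IsProbabilityMeasure P]
    [MeasurableSpace A] [StandardBorelSpace A] {Z : Ω → A} (hZ : Measurable Z) :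
    ∃ κ : Ω → Measure A, Measurable[m] κ ∧ (∀ ω, IsProbabilityMeasure (κ ω)) ∧
      ∀ B, MeasurableSet B →
        (fun ω => (κ ω).real B) =ᵐ[P] P[(Z ⁻¹' B).indicator fun _ => (1 : ℝ) | m] := by
  have : Nonempty A := P.nonempty_of_neZero.map Z
  let κ : @ProbabilityTheory.Kernel Ω A m _ :=
    @ProbabilityTheory.condDistrib Ω Ω A _ _ _ mΩ m Z id P _
  have hid : @Measurable Ω Ω mΩ m id := fun s hs => hm s hs
  refine ⟨@ProbabilityTheory.Kernel.toFun Ω A m _ κ,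
    @ProbabilityTheory.Kernel.measurable' Ω A m _ κ,
    fun ω => ?_, fun B hB => ?_⟩
  · exact @ProbabilityTheory.IsMarkovKernel.isProbabilityMeasure Ω A m _ κ
      (@ProbabilityTheory.instIsMarkovKernelCondDistrib Ω Ω A _ _ _ mΩ P _ id Z m) ω
  · have h := @ProbabilityTheory.condDistrib_ae_eq_condExp Ω Ω A _ _ _ mΩ P _ id Z m B hid hZ hB
    rwa [MeasurableSpace.comap_id] at h

section IsPrediction

variable {T : ℕ} {U : Type u} [MeasurableSpace U] {X : AdaptedProcess.{u, w} T U}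
  {A : BorelSp.{u}} {Z : X.Ω → A.carrier} {Y : X.Ω → (A.prob.path T).carrier}

theorem exists_isPrediction [PolishSpace A.carrier] (hZ : Measurable Z) :
    ∃ Y, IsPrediction X Z Y := by
  choose κ hκ hprob hcond using fun t =>
    exists_regular_conditional_distribution (X.ℱ.le t) X.P hZ
  let Y : Fin (T + 1) → X.Ω → A.prob.carrier := fun t ω => ⟨κ t ω, hprob t ω⟩
  have hmeas : ∀ t, Measurable[X.ℱ t] (Y t) := fun t =>
    (@BorelSp.measurable_prob_iff A X.Ω (X.ℱ t) _ _ (Y t)).2 (hκ t)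
  exact ⟨fun ω t => Y t ω,
    BorelSp.measurable_path fun t => (hmeas t).mono (X.ℱ.le t) le_rfl, hmeas, hcond⟩

theorem isPrediction_predict [PolishSpace A.carrier]
    (Z : {Z : X.Ω → A.carrier // Measurable Z}) : IsPrediction X Z.1 (predict X Z).1 := by
  have h := exists_isPrediction Z.2
  rw [predict, dif_pos h]
  exact h.choose_spec

theorem IsPrediction.setLIntegral_measureOf (h : IsPrediction X Z Y) (hZ : Measurable Z)
    (t : Fin (T + 1)) {s : Set X.Ω} (hs : MeasurableSet[X.ℱ t] s) {B : Set A.carrier}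
    (hB : MeasurableSet B) :
    ∫⁻ ω in s, BorelSp.measureOf (Y ω t) B ∂X.P = X.P.restrict s (Z ⁻¹' B) := by
  have hm := X.ℱ.le t
  have hint : Integrable (fun ω => (BorelSp.measureOf (Y ω t)).real B) X.P :=
    integrable_condExp.congr (h.condLaw t B hB).symm
  calc ∫⁻ ω in s, BorelSp.measureOf (Y ω t) B ∂X.P
      = ∫⁻ ω in s, ENNReal.ofReal ((BorelSp.measureOf (Y ω t)).real B) ∂X.P :=
        lintegral_congr fun ω => (ofReal_measureReal (measure_ne_top _ _)).symm
    _ = ENNReal.ofReal (∫ ω in s, (BorelSp.measureOf (Y ω t)).real B ∂X.P) :=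
        (ofReal_integral_eq_lintegral_ofReal hint.integrableOn
          (ae_of_all _ fun ω => measureReal_nonneg)).symm
    _ = ENNReal.ofReal (∫ ω in s, (Z ⁻¹' B).indicator (fun _ => (1 : ℝ)) ω ∂X.P) := by
        rw [setIntegral_congr_ae (hm s hs) ((h.condLaw t B hB).mono fun ω hω _ => hω),
          setIntegral_condExp hm ((integrable_const _).indicator (hZ hB)) hs]
    _ = X.P.restrict s (Z ⁻¹' B) := by
        rw [integral_indicator_const _ (hZ hB), smul_eq_mul, mul_one, ofReal_measureReal]

theorem IsPrediction.setIntegral_integral [TopologicalSpace.MetrizableSpace A.carrier]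
    [SecondCountableTopology A.carrier] (h : IsPrediction X Z Y) (hZ : Measurable Z)
    (φ : A.carrier →ᵇ ℝ) (t : Fin (T + 1)) {s : Set X.Ω} (hs : MeasurableSet[X.ℱ t] s) :
    ∫ ω in s, ∫ x, φ x ∂BorelSp.measureOf (Y ω t) ∂X.P = ∫ ω in s, φ (Z ω) ∂X.P := by
  let κ : ProbabilityTheory.Kernel X.Ω A.carrier := ⟨fun ω => BorelSp.measureOf (Y ω t),
    BorelSp.measurable_prob_iff.1 ((h.adapted t).mono (X.ℱ.le t) le_rfl)⟩
  have hbind : (X.P.restrict s).bind κ = (X.P.restrict s).map Z := Measure.ext fun B hB => by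
    rw [Measure.bind_apply hB κ.aemeasurable, Measure.map_apply hZ hB]
    exact h.setLIntegral_measureOf hZ t hs hB
  have hφ : Integrable φ ((X.P.restrict s).bind κ) := hbind ▸ φ.integrable _
  calc ∫ ω in s, ∫ x, φ x ∂κ ω ∂X.P
      = ∫ x, φ x ∂(X.P.restrict s).bind κ := by
        rw [Measure.comp_eq_comp_const_apply] at hφ ⊢
        rw [ProbabilityTheory.Kernel.integral_comp hφ, ProbabilityTheory.Kernel.const_apply]
    _ = ∫ ω in s, φ (Z ω) ∂X.P := by
        rw [hbind, integral_map hZ.aemeasurable φ.continuous.aestronglyMeasurable]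

theorem IsPrediction.condExp_ae_eq [TopologicalSpace.MetrizableSpace A.carrier]
    [SecondCountableTopology A.carrier] (h : IsPrediction X Z Y) (hZ : Measurable Z)
    (φ : A.carrier →ᵇ ℝ) (t : Fin (T + 1)) :
    MeasureTheory.condExp (X.ℱ t) X.P (fun ω => φ (Z ω)) =ᵐ[X.P]
      fun ω => ∫ x, φ x ∂BorelSp.measureOf (Y ω t) := by
  have hm := X.ℱ.le t
  have hmeas : Measurable[X.ℱ t] fun ω => ∫ x, φ x ∂BorelSp.measureOf (Y ω t) :=
    (BorelSp.continuous_integral φ).measurable.comp (h.adapted t)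
  have hint : Integrable (fun ω => ∫ x, φ x ∂BorelSp.measureOf (Y ω t)) X.P :=
    .of_bound (hmeas.mono hm le_rfl).aestronglyMeasurable ‖φ‖
      (ae_of_all _ fun ω => BorelSp.norm_integral_le_norm φ (Y ω t))
  have hφ : Integrable (fun ω => φ (Z ω)) X.P :=
    .of_bound (φ.continuous.measurable.comp hZ).aestronglyMeasurable ‖φ‖
      (ae_of_all _ fun ω => φ.norm_coe_le_norm _)
  exact (ae_eq_condExp_of_forall_setIntegral_eq hm hφ (fun s _ _ => hint.integrableOn)
    (fun s hs _ => h.setIntegral_integral hZ φ t hs)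
    hmeas.stronglyMeasurable.aestronglyMeasurable).symm

variable {E : Type*} [MeasurableSpace E] {g : A.carrier → E}

theorem IsPrediction.ae_ae_mem_iff (h : IsPrediction X Z Y) (hZ : Measurable Z)
    (hg : Measurable g) (t : Fin (T + 1)) (hgZ : Measurable[X.ℱ t] fun ω => g (Z ω))
    {s : Set E} (hs : MeasurableSet s) :
    ∀ᵐ ω ∂X.P, ∀ᵐ x ∂BorelSp.measureOf (Y ω t), g x ∈ s ↔ g (Z ω) ∈ s := by
  have hcond : (fun ω => (BorelSp.measureOf (Y ω t)).real (g ⁻¹' s)) =ᵐ[X.P]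
      (Z ⁻¹' (g ⁻¹' s)).indicator fun _ => (1 : ℝ) := by
    have hadapted : StronglyMeasurable[X.ℱ t] ((Z ⁻¹' (g ⁻¹' s)).indicator fun _ => (1 : ℝ)) :=
      stronglyMeasurable_const.indicator (hgZ hs)
    have hcondLaw := h.condLaw t _ (hg hs)
    rwa [condExp_of_stronglyMeasurable (X.ℱ.le t) hadapted
      ((integrable_const _).indicator (hZ (hg hs)))] at hcondLaw
  filter_upwards [hcond] with ω hω
  by_cases hmem : g (Z ω) ∈ s
  · rw [indicator_of_mem (show ω ∈ Z ⁻¹' (g ⁻¹' s) from hmem), measureReal_def,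
      ENNReal.toReal_eq_one_iff, ← prob_compl_eq_zero_iff (hg hs)] at hω
    filter_upwards [measure_eq_zero_iff_ae_notMem.1 hω] with x hx using by simpa [hmem] using hx
  · rw [indicator_of_notMem (show ω ∉ Z ⁻¹' (g ⁻¹' s) from hmem), measureReal_eq_zero_iff] at hω
    filter_upwards [measure_eq_zero_iff_ae_notMem.1 hω] with x hx using by simpa [hmem] using hx

theorem IsPrediction.map_ae_eq_dirac [MeasurableSpace.CountablySeparated E]
    (h : IsPrediction X Z Y) (hZ : Measurable Z) (hg : Measurable g) (t : Fin (T + 1))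
    (hgZ : Measurable[X.ℱ t] fun ω => g (Z ω)) :
    ∀ᵐ ω ∂X.P, (BorelSp.measureOf (Y ω t)).map g = Measure.dirac (g (Z ω)) := by
  obtain ⟨S, hScount, hSmeas, hSsep⟩ := exists_countable_separating E MeasurableSet univ
  filter_upwards [(ae_ball_iff hScount).2 fun s hs =>
    h.ae_ae_mem_iff hZ hg t hgZ (hSmeas s hs)] with ω hω
  have hconst : g =ᵐ[BorelSp.measureOf (Y ω t)] fun _ => g (Z ω) := by
    filter_upwards [(ae_ball_iff hScount).2 hω] with x hx
    exact hSsep _ (mem_univ _) _ (mem_univ _) hx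
  rw [Measure.map_congr hconst, Measure.map_const, measure_univ, one_smul]

end IsPrediction

section Prediction

variable {T : ℕ} {U : Type u} [MeasurableSpace U] [TopologicalSpace U] [BorelSpace U]

/-- The space `I → Prob_k(U)` in which the rank `k` prediction process takes its values. -/
abbrev predictionSpace (T : ℕ) (U : Type u) [MeasurableSpace U] [TopologicalSpace U]
    [BorelSpace U] (k : ℕ) : BorelSp.{u} :=
  (probRank T (BorelSp.of U) k).path T

variable [PolishSpace U]

theorem AdaptedProcess.isPrediction_prediction (X : AdaptedProcess.{u, w} T U) (k : ℕ) :
    IsPrediction X (X.prediction k).1 (X.prediction (k + 1)).1 :=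
  isPrediction_predict (X.prediction k)

theorem AdaptedProcess.measurable_prediction_apply (X : AdaptedProcess.{u, w} T U)
    (t : Fin (T + 1)) :
    ∀ k, Measurable[X.ℱ t] fun ω => ((X.prediction k).1 ω t : (probRank T (BorelSp.of U) k).carrier)
  | 0 => X.adapted t
  | k + 1 => (X.isPrediction_prediction k).adapted t

theorem AdaptedProcess.map_eval_prediction_ae_eq_dirac (X : AdaptedProcess.{u, w} T U) (k : ℕ)
    (t : Fin (T + 1)) : ∀ᵐ ω ∂X.P,
      (BorelSp.measureOf (X := predictionSpace T U k) ((X.prediction (k + 1)).1 ω t)).map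
          (fun x => (x t : (probRank T (BorelSp.of U) k).carrier)) =
        Measure.dirac ((X.prediction k).1 ω t : (probRank T (BorelSp.of U) k).carrier) :=
  (X.isPrediction_prediction k).map_ae_eq_dirac (X.prediction k).2
    (BorelSp.continuous_eval t).measurable t (X.measurable_prediction_apply t k)

end Prediction

/-! ### Adapted functionals as continuous functions of the prediction process -/

theorem exists_boundedContinuousFunction_eqOn {E : Type*} [TopologicalSpace E] [T4Space E]
    {K : Set E} (hK : IsCompact K) {G : E → ℝ} (hG : ContinuousOn G K) :
    ∃ g : E →ᵇ ℝ, EqOn g G K := by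
  have : CompactSpace K := isCompact_iff_compactSpace.1 hK
  obtain ⟨g, -, hg⟩ := BoundedContinuousFunction.exists_extension_norm_eq_of_isClosedEmbedding
    (BoundedContinuousFunction.mkOfCompact ⟨K.domRestrict G, hG.domRestrict⟩)
    hK.isClosed.isClosedEmbedding_subtypeVal
  exact ⟨g, fun x hx => congrFun hg ⟨x, hx⟩⟩

theorem exists_boundedContinuousFunction_ne {E : Type*} [TopologicalSpace E] [T4Space E]
    {x y : E} (h : x ≠ y) : ∃ φ : E →ᵇ ℝ, φ x ≠ φ y := by
  obtain ⟨φ, hx, hy, -⟩ := exists_bounded_zero_one_of_closed isClosed_singleton isClosed_singleton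
    (disjoint_singleton.2 h)
  exact ⟨φ, by simp [hx (mem_singleton x), hy (mem_singleton y)]⟩

section Represents

variable {T : ℕ} {U : Type u} [MeasurableSpace U] [TopologicalSpace U] [BorelSpace U]
  [PolishSpace U] {k : ℕ}

/-- The adapted functional `f` is, almost surely and for every process, the bounded continuous
function `φ` of the rank `k` prediction process. -/
def Represents (k : ℕ) (f : AdaptedFunctional T U) (φ : (predictionSpace T U k).carrier →ᵇ ℝ) :
    Prop :=
  ∀ X : AdaptedProcess.{u, w} T U, f.eval X =ᵐ[X.P] fun ω => φ ((X.prediction k).1 ω)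

variable {f : AdaptedFunctional T U} {φ : (predictionSpace T U k).carrier →ᵇ ℝ}

theorem Represents.expect_eq (h : Represents.{u, w} k f φ) (X : AdaptedProcess.{u, w} T U) :
    f.expect X =
      ∫ x, φ x ∂BorelSp.measureOf (X := predictionSpace T U k) (X.lawPrediction k) := by
  rw [AdaptedFunctional.expect, integral_congr_ae (h X)]
  exact (integral_map (X.prediction k).2.aemeasurable φ.continuous.aestronglyMeasurable).symm

theorem Represents.comp {n : ℕ} {f : Fin n → AdaptedFunctional T U}
    {φ : Fin n → (predictionSpace T U k).carrier →ᵇ ℝ}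
    (h : ∀ i, Represents.{u, w} k (f i) (φ i)) (g : (Fin n → ℝ) →ᵇ ℝ) :
    Represents.{u, w} k (.comp g f)
      (g.compContinuous ⟨fun x i => φ i x, continuous_pi fun i => (φ i).continuous⟩) := by
  intro X
  filter_upwards [ae_all_iff.2 fun i => h i X] with ω hω
  simp only [AdaptedFunctional.eval, hω]
  rfl

/-- Integration of `φ` against the time `t` value of a path of probability measures. -/
def integralAt {A : BorelSp.{u}} (t : Fin (T + 1)) (φ : A.carrier →ᵇ ℝ) :
    (A.prob.path T).carrier →ᵇ ℝ :=
  BoundedContinuousFunction.ofNormedAddCommGroup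
    (fun m => ∫ x, φ x ∂BorelSp.measureOf (m t))
    ((BorelSp.continuous_integral φ).comp (BorelSp.continuous_eval t)) ‖φ‖
    fun m => BorelSp.norm_integral_le_norm φ (m t)

theorem Represents.condExp (h : Represents.{u, w} k f φ) (t : Fin (T + 1)) :
    Represents.{u, w} (k + 1) (.condExp t f) (integralAt (A := predictionSpace T U k) t φ) :=
  fun X => (condExp_congr_ae (h X)).trans
    ((X.isPrediction_prediction k).condExp_ae_eq (X.prediction k).2 φ t)

/-- The time `t` marginal of `X̂^{k+1}_t` is the Dirac measure at `X̂^k_t`. Since the Dirac measures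
form a closed copy of the base space, `φ` extends by Tietze to a function of the marginals. -/
theorem exists_prediction_lift (φ : (predictionSpace T U k).carrier →ᵇ ℝ) :
    ∃ ψ : (predictionSpace T U (k + 1)).carrier →ᵇ ℝ,
      ∀ X : AdaptedProcess.{u, w} T U, ∀ᵐ ω ∂X.P,
        ψ ((X.prediction (k + 1)).1 ω) = φ ((X.prediction k).1 ω) := by
  let A := probRank T (BorelSp.of U) k
  let dirac : (A.path T).carrier → Fin (T + 1) → ProbabilityMeasure A.carrier :=
    fun z t => diracProba (z t : A.carrier)
  have hdirac : IsClosedEmbedding dirac :=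
    IsClosedEmbedding.piMap (ι := Fin (T + 1)) (A := fun _ => A.carrier)
      fun _ => isClosedEmbedding_diracProba
  obtain ⟨ψ, -, hψ⟩ :=
    BoundedContinuousFunction.exists_extension_norm_eq_of_isClosedEmbedding φ hdirac
  have heval : ∀ t, Continuous fun x : (A.path T).carrier => (x t : A.carrier) :=
    BorelSp.continuous_eval
  let marginals : ((A.path T).prob.path T).carrier → Fin (T + 1) → ProbabilityMeasure A.carrier :=
    fun m t => ProbabilityMeasure.map (Ω := (A.path T).carrier) (m t)
      (f := fun x => (x t : A.carrier)) (heval t).measurable.aemeasurable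
  have hmarginals : Continuous marginals := continuous_pi fun t =>
    (ProbabilityMeasure.continuous_map (heval t)).comp
      (BorelSp.continuous_eval (A := (A.path T).prob) t)
  refine ⟨ψ.compContinuous ⟨marginals, hmarginals⟩, fun X => ?_⟩
  filter_upwards [ae_all_iff.2 fun t => X.map_eval_prediction_ae_eq_dirac k t] with ω hω
  have heq : marginals ((X.prediction (k + 1)).1 ω) = dirac ((X.prediction k).1 ω) :=
    funext fun t => Subtype.ext (hω t)
  exact (congrArg ψ heq).trans (congrFun hψ _)

theorem Represents.exists_of_le (h : Represents.{u, w} k f φ) {l : ℕ} (hkl : k ≤ l) :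
    ∃ ψ, Represents.{u, w} l f ψ := by
  induction l, hkl using Nat.le_induction with
  | base => exact ⟨φ, h⟩
  | succ l _ ih =>
    obtain ⟨ψ, hψ⟩ := ih
    obtain ⟨χ, hχ⟩ := exists_prediction_lift.{u, w} ψ
    refine ⟨χ, fun X => ?_⟩
    filter_upwards [hψ X, hχ X] with ω hψω hχω
    rw [hψω, hχω]

theorem represents_marginal {n : ℕ} (t : Fin n → Fin (T + 1)) (f : (Fin n → U) →ᵇ ℝ) :
    Represents.{u, w} 0 (.marginal t f) (f.compContinuous
      ⟨fun (x : (predictionSpace T U 0).carrier) i => (x (t i) : U),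
        continuous_pi fun i => BorelSp.continuous_eval (A := BorelSp.of U) (t i)⟩) :=
  fun _ => Eventually.of_forall fun _ => rfl

theorem exists_represents (f : AdaptedFunctional T U) (hf : f.rank ≤ k) :
    ∃ φ, Represents.{u, w} k f φ := by
  induction f generalizing k with
  | marginal t f => exact (represents_marginal t f).exists_of_le k.zero_le
  | comp g f ih =>
    choose φ hφ using fun i => ih i ((Finset.le_sup (Finset.mem_univ i)).trans hf)
    exact ⟨_, Represents.comp hφ g⟩
  | condExp t f ih =>
    obtain ⟨k, rfl⟩ := Nat.exists_eq_succ_of_ne_zero (Nat.ne_zero_of_lt hf)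
    obtain ⟨φ, hφ⟩ := ih (Nat.le_of_succ_le_succ hf)
    exact ⟨_, hφ.condExp t⟩

/-- The bounded continuous functions of the rank `k` prediction process that are adapted
functionals of rank at most `k`. -/
def representables (T : ℕ) (U : Type u) [MeasurableSpace U] [TopologicalSpace U] [BorelSpace U]
    [PolishSpace U] (k : ℕ) : Set ((predictionSpace T U k).carrier →ᵇ ℝ) :=
  {φ | ∃ f ∈ AF T U k, Represents.{u, w} k f φ}

theorem comp_mem_representables {n : ℕ} {φ : Fin n → (predictionSpace T U k).carrier →ᵇ ℝ}
    (hφ : ∀ i, φ i ∈ representables.{u, w} T U k) {G : (Fin n → ℝ) → ℝ} (hG : Continuous G)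
    {χ : (predictionSpace T U k).carrier →ᵇ ℝ} (hχ : ∀ x, χ x = G fun i => φ i x) :
    χ ∈ representables.{u, w} T U k := by
  choose f hf hfφ using hφ
  obtain ⟨g, hg⟩ := exists_boundedContinuousFunction_eqOn
    (isCompact_closedBall (0 : Fin n → ℝ) ‖φ‖) hG.continuousOn
  have hrank : (AdaptedFunctional.comp g f).rank ≤ k := Finset.sup_le fun i _ => hf i
  refine ⟨.comp g f, hrank, ?_⟩
  convert Represents.comp hfφ g using 1
  ext x
  refine (hχ x).trans (hg ?_).symm
  rw [mem_closedBall_zero_iff, pi_norm_le_iff_of_nonneg (norm_nonneg _)]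
  exact fun i => ((φ i).norm_coe_le_norm x).trans (norm_le_pi_norm φ i)

/-- `representables` as a subalgebra of the bounded continuous functions. -/
def representableAlgebra (T : ℕ) (U : Type u) [MeasurableSpace U] [TopologicalSpace U]
    [BorelSpace U] [PolishSpace U] (k : ℕ) :
    StarSubalgebra ℝ ((predictionSpace T U k).carrier →ᵇ ℝ) where
  carrier := representables.{u, w} T U k
  mul_mem' {φ ψ} hφ hψ := comp_mem_representables (φ := ![φ, ψ]) (G := fun v => v 0 * v 1)
    (Fin.forall_fin_two.2 ⟨hφ, hψ⟩) (by fun_prop) fun _ => rfl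
  add_mem' {φ ψ} hφ hψ := comp_mem_representables (φ := ![φ, ψ]) (G := fun v => v 0 + v 1)
    (Fin.forall_fin_two.2 ⟨hφ, hψ⟩) (by fun_prop) fun _ => rfl
  algebraMap_mem' a := comp_mem_representables (φ := ![]) (G := fun _ => a)
    (fun i => i.elim0) continuous_const fun _ => rfl
  star_mem' {φ} hφ := by
    rwa [show star φ = φ by ext x; simp]

theorem BorelSp.eq_of_forall_integral_eq {A : BorelSp.{u}} [PolishSpace A.carrier]
    {S : StarSubalgebra ℝ (A.carrier →ᵇ ℝ)} (hS : ∀ x y, x ≠ y → ∃ φ ∈ S, φ x ≠ φ y)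
    {μ ν : A.prob.carrier}
    (h : ∀ φ ∈ S, ∫ x, φ x ∂BorelSp.measureOf μ = ∫ x, φ x ∂BorelSp.measureOf ν) : μ = ν := by
  refine BorelSp.measureOf_injective
    (ext_of_forall_mem_subalgebra_integral_eq_of_polish (𝕜 := ℝ) (A := S) ?_ h)
  intro x y hxy
  obtain ⟨φ, hφ, hne⟩ := hS x y hxy
  exact ⟨φ, ⟨φ.toContinuousMap, ⟨φ, hφ, rfl⟩, rfl⟩, hne⟩

theorem exists_mem_representableAlgebra_ne {x y : (predictionSpace T U k).carrier} (hxy : x ≠ y) :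
    ∃ φ ∈ representableAlgebra.{u, w} T U k, φ x ≠ φ y := by
  induction k with
  | zero =>
    obtain ⟨φ, hφ⟩ := exists_boundedContinuousFunction_ne (E := Fin (T + 1) → U) hxy
    exact ⟨_, ⟨_, Nat.zero_le _, represents_marginal id φ⟩, hφ⟩
  | succ k ih =>
    obtain ⟨t, ht⟩ := Function.ne_iff.1 hxy
    by_contra! hcon
    refine ht (BorelSp.eq_of_forall_integral_eq (A := predictionSpace T U k)
      (S := representableAlgebra.{u, w} T U k) (fun _ _ => ih) fun φ hφ => ?_)
    obtain ⟨f, hf, hfφ⟩ := hφ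
    exact hcon (integralAt (A := predictionSpace T U k) t φ)
      ⟨.condExp t f, Nat.succ_le_succ hf, hfφ.condExp t⟩

/-- The integrals of all representable functions; by `tau_eq_induced` these are the coordinates
that define `τ_r`. -/
def representableIntegrals (T : ℕ) (U : Type u) [MeasurableSpace U]
    [TopologicalSpace U] [BorelSpace U] [PolishSpace U] (r : ℕ)
    (μ : (probRank T (BorelSp.of U) (r + 1)).carrier) (φ : representables.{u, w} T U r) : ℝ :=
  ∫ x, φ.1 x ∂BorelSp.measureOf (X := predictionSpace T U r) μ

theorem continuous_representableIntegrals (r : ℕ) :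
    Continuous (representableIntegrals.{u, w} T U r) :=
  continuous_pi fun φ => BorelSp.continuous_integral (A := predictionSpace T U r) φ.1

theorem injective_representableIntegrals (r : ℕ) :
    Function.Injective (representableIntegrals.{u, w} T U r) := fun _ _ h =>
  BorelSp.eq_of_forall_integral_eq (A := predictionSpace T U r)
    (S := representableAlgebra.{u, w} T U r) (fun _ _ => exists_mem_representableAlgebra_ne)
    fun φ hφ => congrFun h ⟨φ, hφ⟩

theorem forall_expect_eq_iff (r : ℕ) (X Y : AdaptedProcess.{u, w} T U) :
    (∀ f ∈ AF T U r, f.expect X = f.expect Y) ↔ X.lawPrediction r = Y.lawPrediction r := by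
  constructor
  · refine fun h => injective_representableIntegrals.{u, w} r (funext fun φ => ?_)
    obtain ⟨f, hf, hφ⟩ := φ.2
    exact ((hφ.expect_eq X).symm.trans (h f hf)).trans (hφ.expect_eq Y)
  · intro h f hf
    obtain ⟨φ, hφ⟩ := exists_represents.{u, w} f hf
    rw [hφ.expect_eq, hφ.expect_eq, h]

theorem tau_eq_induced (r : ℕ) :
    tau.{u, w} T U r = TopologicalSpace.induced
      (fun X => representableIntegrals.{u, w} T U r (X.lawPrediction r)) inferInstance := by
  rw [Pi.topologicalSpace, induced_iInf]
  simp only [induced_compose]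
  refine le_antisymm (le_iInf fun φ => ?_) (le_iInf₂ fun f hf => ?_)
  · obtain ⟨f, hf, hφ⟩ := φ.2
    refine (iInf₂_le f hf).trans_eq ?_
    rw [funext hφ.expect_eq]
    rfl
  · obtain ⟨φ, hφ⟩ := exists_represents.{u, w} f hf
    refine (iInf_le _ (⟨φ, f, hf, hφ⟩ : representables.{u, w} T U r)).trans_eq ?_
    rw [funext hφ.expect_eq]
    rfl

end Represents

/-! ### Shuffles and deconcatenation of words -/

section Words

variable {E R : Type*} [CommSemiring R]

/-- The list of all shuffles of two words, with multiplicity. -/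
def shuffles : List E → List E → List (List E)
  | [], v => [v]
  | a :: u, [] => [a :: u]
  | a :: u, b :: v => (shuffles u (b :: v)).map (a :: ·) ++ (shuffles (a :: u) v).map (b :: ·)
termination_by u v => u.length + v.length

/-- The linear extension of a function `f` of words, evaluated at the shuffle product of `u`
and `v`. -/
def shuffleSum (f : List E → R) (u v : List E) : R := ((shuffles u v).map f).sum

@[simp] theorem shuffleSum_nil_left (f : List E → R) (v : List E) : shuffleSum f [] v = f v := by
  simp [shuffleSum, shuffles]

@[simp] theorem shuffleSum_nil_right (f : List E → R) (u : List E) : shuffleSum f u [] = f u := by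
  cases u <;> simp [shuffleSum, shuffles]

theorem shuffleSum_cons_cons (f : List E → R) (a b : E) (u v : List E) :
    shuffleSum f (a :: u) (b :: v) =
      shuffleSum (fun w => f (a :: w)) u (b :: v) +
        shuffleSum (fun w => f (b :: w)) (a :: u) v := by
  simp [shuffleSum, shuffles, Function.comp_def]

theorem shuffleSum_add (f g : List E → R) (u v : List E) :
    shuffleSum (fun w => f w + g w) u v = shuffleSum f u v + shuffleSum g u v := by
  simp [shuffleSum, List.sum_map_add]

theorem shuffleSum_mul_left (c : R) (f : List E → R) (u v : List E) :
    shuffleSum (fun w => c * f w) u v = c * shuffleSum f u v := by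
  simp [shuffleSum, List.sum_map_mul_left]

theorem shuffleSum_length_mul (c : ℕ → R) (f : List E → R) (u v : List E) :
    shuffleSum (fun w => c w.length * f w) u v = c (u.length + v.length) * shuffleSum f u v := by
  induction u, v using shuffles.induct generalizing c f with
  | case1 v => simp
  | case2 a u => simp
  | case3 a u b v ih_left ih_right =>
    simp only [shuffleSum_cons_cons, List.length_cons,
      ih_left (fun n => c (n + 1)) fun w => f (a :: w),
      ih_right (fun n => c (n + 1)) fun w => f (b :: w)]
    rw [mul_add]
    congr 3
    ring

theorem shuffleSum_prod (φ : E → R) (u v : List E) :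
    shuffleSum (fun w => (w.map φ).prod) u v =
      ((u.length + v.length).choose u.length : R) * ((u.map φ).prod * (v.map φ).prod) := by
  induction u, v using shuffles.induct with
  | case1 v => simp
  | case2 a u => simp
  | case3 a u b v ih_left ih_right =>
    have hpascal : (u.length + 1 + (v.length + 1)).choose (u.length + 1) =
        (u.length + (v.length + 1)).choose u.length +
          (u.length + 1 + v.length).choose (u.length + 1) := by
      rw [show u.length + 1 + (v.length + 1) = u.length + (v.length + 1) + 1 by ring,
        Nat.choose_succ_succ, show u.length + 1 + v.length = u.length + (v.length + 1) by ring]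
    simp only [shuffleSum_cons_cons, List.map_cons, List.prod_cons, shuffleSum_mul_left, ih_left,
      ih_right, List.length_cons, hpascal]
    push_cast
    ring

/-- The sum of `G p q` over the deconcatenations `u = p ++ q`. -/
def splitSum : (List E → List E → R) → List E → R
  | G, [] => G [] []
  | G, a :: u => G [] (a :: u) + splitSum (fun p q => G (a :: p) q) u

theorem splitSum_add (G H : List E → List E → R) (u : List E) :
    splitSum (fun p q => G p q + H p q) u = splitSum G u + splitSum H u := by
  induction u generalizing G H with
  | nil => rfl
  | cons a u ih => simp only [splitSum, ih]; ring

theorem splitSum_mul_left (c : R) (G : List E → List E → R) (u : List E) :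
    splitSum (fun p q => c * G p q) u = c * splitSum G u := by
  induction u generalizing G with
  | nil => rfl
  | cons a u ih => simp only [splitSum, ih]; ring

theorem splitSum_eq_sum (G : List E → List E → R) (u : List E) :
    splitSum G u = ∑ i ∈ Finset.range (u.length + 1), G (u.take i) (u.drop i) := by
  induction u generalizing G with
  | nil => simp [splitSum]
  | cons a u ih =>
    rw [splitSum, ih, List.length_cons, Finset.sum_range_succ' _ (u.length + 1)]
    simp [add_comm]

theorem splitSum_replicate_append (G : List E → List E → R) (e l : E) (a : ℕ) :
    splitSum G (List.replicate a e ++ [l]) = ∑ p ∈ Finset.HasAntidiagonal.antidiagonal a,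
      G (List.replicate p.1 e) (List.replicate p.2 e ++ [l]) +
        G (List.replicate a e ++ [l]) [] := by
  induction a generalizing G with
  | zero => simp [splitSum]
  | succ a ih =>
    rw [List.replicate_succ, List.cons_append, splitSum, ih, Finset.Nat.sum_antidiagonal_succ,
      ← add_assoc]
    rfl

/-- The convolution product of functions of words, dual to deconcatenation. -/
def wordConv (f h : List E → R) (u : List E) : R := splitSum (fun p q => f p * h q) u

theorem wordConv_cons (f h : List E → R) (a : E) (u : List E) :
    wordConv f h (a :: u) = f [] * h (a :: u) + wordConv (fun w => f (a :: w)) h u := rfl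

theorem shuffleSum_wordConv (f h : List E → R) (u v : List E) :
    shuffleSum (wordConv f h) u v = splitSum (fun p q => splitSum
      (fun p' q' => shuffleSum f p p' * shuffleSum h q q') v) u := by
  induction u, v using shuffles.induct generalizing f with
  | case1 v => simp [splitSum, wordConv]
  | case2 a u => simp [splitSum, wordConv]
  | case3 a u b v ih_left ih_right =>
    rw [shuffleSum_cons_cons]
    simp only [wordConv_cons, shuffleSum_add, shuffleSum_mul_left, ih_left, ih_right]
    simp only [splitSum, shuffleSum_nil_left, shuffleSum_nil_right, shuffleSum_cons_cons, add_mul,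
      splitSum_add]
    ring

/-- Characters of the shuffle algebra: functions of words whose linear extension is multiplicative
for the shuffle product. -/
structure IsGroupLike (f : List E → R) : Prop where
  nil : f [] = 1
  mul : ∀ u v, f u * f v = shuffleSum f u v

theorem IsGroupLike.wordConv {f h : List E → R} (hf : IsGroupLike f) (hh : IsGroupLike h) :
    IsGroupLike (wordConv f h) where
  nil := by simp [AdaptedSig.wordConv, splitSum, hf.nil, hh.nil]
  mul u v := by
    have hinner (p q : List E) : splitSum (fun p' q' => f p * f p' * (h q * h q')) v =
        AdaptedSig.wordConv f h v * (f p * h q) := by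
      rw [mul_comm, AdaptedSig.wordConv, ← splitSum_mul_left]
      congr 1
      funext p' q'
      ring
    simp only [shuffleSum_wordConv, ← hf.mul, ← hh.mul, hinner]
    rw [splitSum_mul_left, mul_comm]
    rfl

theorem IsGroupLike.scale {f : List E → R} (hf : IsGroupLike f) (c : R) :
    IsGroupLike fun w => c ^ w.length * f w where
  nil := by simp [hf.nil]
  mul u v := by
    rw [shuffleSum_length_mul (fun n => c ^ n), ← hf.mul, pow_add]
    ring

theorem isGroupLike_exp {K : Type*} [Field K] [CharZero K] (φ : E → K) :
    IsGroupLike fun w : List E => (w.length.factorial : K)⁻¹ * (w.map φ).prod where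
  nil := by simp
  mul u v := by
    have hchoose : ((u.length + v.length).choose u.length : K) * u.length.factorial *
        v.length.factorial = (u.length + v.length).factorial := by
      rw [Nat.choose_symm_add]
      exact_mod_cast Nat.add_choose_mul_factorial_mul_factorial u.length v.length
    have hne : ((u.length + v.length).choose u.length : K) ≠ 0 :=
      Nat.cast_ne_zero.2 (Nat.choose_pos (Nat.le_add_right _ _)).ne'
    have hu : (u.length.factorial : K) ≠ 0 := Nat.cast_ne_zero.2 (Nat.factorial_ne_zero _)
    have hv : (v.length.factorial : K) ≠ 0 := Nat.cast_ne_zero.2 (Nat.factorial_ne_zero _)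
    rw [shuffleSum_length_mul (fun n => (n.factorial : K)⁻¹), shuffleSum_prod, ← hchoose]
    field_simp

end Words

/-! ### Tensor series as functions of words -/

section TensorWords

variable {W : Type u} [NormedAddCommGroup W] [NormedSpace ℝ W]

/-- The linear form `ℓ₁ ⊗ ⋯ ⊗ ℓₙ`, written as in `AdmissibleNorm.dual_le`. -/
def tensorForm {n : ℕ} (ℓ : Fin n → (W →L[ℝ] ℝ)) : ⨂[ℝ]^n W →ₗ[ℝ] ℝ :=
  PiTensorProduct.lift ((MultilinearMap.mkPiAlgebra ℝ (Fin n) ℝ).compLinearMap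
    fun i => (ℓ i : W →ₗ[ℝ] ℝ))

theorem tensorForm_tprod {n : ℕ} (ℓ : Fin n → (W →L[ℝ] ℝ)) (v : Fin n → W) :
    tensorForm ℓ (PiTensorProduct.tprod ℝ v) = ∏ i, ℓ i (v i) := by
  simp [tensorForm]

/-- The tensor product `tpMul` as a bilinear map. -/
def tpMulₗ (W : Type u) [NormedAddCommGroup W] [NormedSpace ℝ W] (m n : ℕ) :
    ⨂[ℝ]^m W →ₗ[ℝ] ⨂[ℝ]^n W →ₗ[ℝ] ⨂[ℝ]^(m + n) W :=
  (TensorProduct.mk ℝ (⨂[ℝ]^m W) (⨂[ℝ]^n W)).compr₂ TensorPower.mulEquiv.toLinearMap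

theorem tpMulₗ_apply {m n : ℕ} (s : ⨂[ℝ]^m W) (t : ⨂[ℝ]^n W) : tpMulₗ W m n s t = tpMul s t := rfl

theorem tpMul_tprod {m n : ℕ} (a : Fin m → W) (b : Fin n → W) :
    tpMul (PiTensorProduct.tprod ℝ a) (PiTensorProduct.tprod ℝ b) =
      PiTensorProduct.tprod ℝ (Fin.append a b) :=
  TensorPower.tprod_mul_tprod ℝ a b

theorem tensorForm_tpMul {m n : ℕ} (ℓ : Fin (m + n) → (W →L[ℝ] ℝ)) (s : ⨂[ℝ]^m W)
    (t : ⨂[ℝ]^n W) : tensorForm ℓ (tpMul s t) =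
      tensorForm (fun i => ℓ (Fin.castAdd n i)) s * tensorForm (fun i => ℓ (Fin.natAdd m i)) t := by
  have hbilin : (tpMulₗ W m n).compr₂ (tensorForm ℓ) =
      (LinearMap.mul ℝ ℝ).compl₁₂ (tensorForm fun i => ℓ (Fin.castAdd n i))
        (tensorForm fun i => ℓ (Fin.natAdd m i)) := by
    ext a b
    simp only [LinearMap.compMultilinearMap_apply, LinearMap.compr₂_apply, LinearMap.compl₁₂_apply,
      tpMulₗ_apply, tpMul_tprod, tensorForm_tprod, LinearMap.mul_apply', Fin.prod_univ_add,
      Fin.append_left, Fin.append_right]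
  exact LinearMap.congr_fun₂ hbilin s t

theorem tensorForm_cast {m n : ℕ} (h : m = n) (ℓ : Fin n → (W →L[ℝ] ℝ)) (t : ⨂[ℝ]^m W) :
    tensorForm ℓ (TensorPower.cast ℝ W h t) = tensorForm (fun i => ℓ (Fin.cast h i)) t := by
  subst h
  rw [TensorPower.cast_refl]
  rfl

theorem tensorForm_congr (s : TSeries W) {m n : ℕ} (h : m = n) {ℓ : Fin m → (W →L[ℝ] ℝ)}
    {ℓ' : Fin n → (W →L[ℝ] ℝ)} (hℓ : ∀ i, ℓ i = ℓ' (Fin.cast h i)) :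
    tensorForm ℓ (s m) = tensorForm ℓ' (s n) := by
  subst h
  rw [funext hℓ]
  rfl

/-- The value `(ℓ₁ ⊗ ⋯ ⊗ ℓₙ)(s_n)` of a tensor series on a word `ℓ₁ ⋯ ℓₙ` of functionals. -/
def wordEval (s : TSeries W) (w : List (W →L[ℝ] ℝ)) : ℝ := tensorForm w.get (s w.length)

theorem wordEval_tmul (s t : TSeries W) :
    wordEval (tmul s t) = wordConv (wordEval s) (wordEval t) := by
  funext w
  rw [wordConv, splitSum_eq_sum, wordEval, tmul, map_sum, Finset.sum_range]
  refine Finset.sum_congr rfl fun i _ => ?_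
  have hi : (i : ℕ) ≤ w.length := Nat.le_of_lt_succ i.2
  rw [tensorForm_cast, tensorForm_tpMul]
  congr 1
  · exact tensorForm_congr s (by simp [hi]) fun j => by simp
  · exact tensorForm_congr t (by simp) fun j => by simp

theorem wordEval_texp (v : W) : wordEval (texp v) =
    fun w => (w.length.factorial : ℝ)⁻¹ * (w.map fun ℓ => ℓ v).prod := by
  funext w
  rw [wordEval, texp, map_smul, tensorForm_tprod, smul_eq_mul, ← List.prod_ofFn]
  conv_rhs => rw [← List.ofFn_get w, List.map_ofFn, List.length_ofFn]
  rfl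

theorem isGroupLike_wordEval_texp (v : W) : IsGroupLike (wordEval (texp v)) := by
  rw [wordEval_texp]
  exact isGroupLike_exp fun ℓ : W →L[ℝ] ℝ => ℓ v

theorem tone_eq_texp_zero : (tone : TSeries W) = texp 0 := by
  funext m
  cases m with
  | zero =>
    rw [tone, Pi.single_eq_same, texp, Nat.factorial_zero, Nat.cast_one, inv_one, one_smul]
    change PiTensorProduct.tprod ℝ _ = _
    congr 1
    exact funext fun i => i.elim0
  | succ m =>
    rw [tone, Pi.single_eq_of_ne (Nat.succ_ne_zero m), texp,
      MultilinearMap.map_coord_zero _ (0 : Fin (m + 1)) rfl, smul_zero]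

/-- The ordered product `exp(v₀) ⋯ exp(vₙ₋₁)`, of which `sigSeries x` is the case `v = incr x`. -/
def texpProd {n : ℕ} (v : Fin n → W) : TSeries W := (List.ofFn fun i => texp (v i)).foldr tmul tone

theorem texpProd_zero (v : Fin 0 → W) : texpProd v = texp 0 := by
  rw [texpProd, List.ofFn_zero, List.foldr_nil, tone_eq_texp_zero]

theorem texpProd_succ {n : ℕ} (v : Fin (n + 1) → W) :
    texpProd v = tmul (texp (v 0)) (texpProd fun i => v i.succ) := by
  rw [texpProd, List.ofFn_succ, List.foldr_cons]
  rfl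

theorem sigSeries_eq_texpProd {T : ℕ} (x : Fin (T + 1) → W) : sigSeries x = texpProd (incr x) := rfl

theorem isGroupLike_wordEval_texpProd {n : ℕ} (v : Fin n → W) :
    IsGroupLike (wordEval (texpProd v)) := by
  induction n with
  | zero =>
    rw [texpProd_zero]
    exact isGroupLike_wordEval_texp 0
  | succ n ih =>
    rw [texpProd_succ, wordEval_tmul]
    exact (isGroupLike_wordEval_texp _).wordConv (ih _)

/-! ### Injectivity of the signature -/

-- The letter `e` stands for time: on the words `e ⋯ e ℓ` the product of exponentials has a
-- generating function from which the numbers `ℓ (v i)` can be read off.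
open PowerSeries in
theorem mk_wordEval_texpProd_replicate {n : ℕ} (v : Fin n → W) (e ℓ : W →L[ℝ] ℝ)
    (he : ∀ i, e (v i) = 1) :
    (mk fun a => wordEval (texpProd v) (List.replicate a e ++ [ℓ])) =
      (∑ i : Fin n, C (ℓ (v i)) * exp ℝ ^ (i : ℕ)) * mk fun a => (((a + 1).factorial : ℝ)⁻¹) := by
  induction n with
  | zero =>
    ext a
    simp [texpProd_zero, wordEval_texp]
  | succ n ih =>
    have hfactor : ∑ i : Fin n, C (ℓ (v i.succ)) * (exp ℝ * exp ℝ ^ (i : ℕ)) =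
        exp ℝ * ∑ i : Fin n, C (ℓ (v i.succ)) * exp ℝ ^ (i : ℕ) := by
      rw [Finset.mul_sum]
      exact Finset.sum_congr rfl fun i _ => by ring
    rw [Fin.sum_univ_succ]
    simp only [Fin.val_zero, pow_zero, mul_one, Fin.val_succ, pow_succ']
    rw [hfactor, add_mul, mul_assoc, ← ih (fun i => v i.succ) fun i => he i.succ]
    ext a
    rw [map_add, coeff_mk, texpProd_succ, wordEval_tmul, wordConv, splitSum_replicate_append,
      (isGroupLike_wordEval_texpProd _).nil, coeff_C_mul, coeff_mk, coeff_mul, add_comm]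
    congr 1
    · simp [wordEval_texp, he, mul_comm]
    · exact Finset.sum_congr rfl fun p _ => by simp [wordEval_texp, he, coeff_exp]

-- Comparing coefficients gives a Vandermonde system with the nodes `0, 1, …, n - 1`.
theorem eq_of_sum_exp_pow_eq {n : ℕ} {c d : Fin n → ℝ}
    (h : ∑ i : Fin n, PowerSeries.C (c i) * PowerSeries.exp ℝ ^ (i : ℕ) =
      ∑ i : Fin n, PowerSeries.C (d i) * PowerSeries.exp ℝ ^ (i : ℕ)) : c = d := by
  have hnodes : Function.Injective fun i : Fin n => ((i : ℕ) : ℝ) :=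
    Nat.cast_injective.comp Fin.val_injective
  refine sub_eq_zero.1 (Matrix.eq_zero_of_forall_pow_sum_mul_pow_eq_zero hnodes fun a => ?_)
  have hcoeff := congrArg (PowerSeries.coeff (a : ℕ)) h
  simp only [map_sum, PowerSeries.coeff_C_mul, PowerSeries.exp_pow_eq_rescale_exp,
    PowerSeries.coeff_rescale, PowerSeries.coeff_exp, ← mul_assoc, ← Finset.sum_mul] at hcoeff
  have hfactorial : algebraMap ℚ ℝ (1 / ((a : ℕ).factorial : ℚ)) ≠ 0 := by
    simpa using Nat.factorial_ne_zero (a : ℕ)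
  simp only [Pi.sub_apply, sub_mul, Finset.sum_sub_distrib, mul_right_cancel₀ hfactorial hcoeff,
    sub_self]

theorem eq_of_wordEval_texpProd_eq {n : ℕ} {v v' : Fin n → W} (e : W →L[ℝ] ℝ)
    (hv : ∀ i, e (v i) = 1) (hv' : ∀ i, e (v' i) = 1)
    (h : wordEval (texpProd v) = wordEval (texpProd v')) : v = v' := by
  have hne : (PowerSeries.mk fun a => (((a + 1).factorial : ℝ)⁻¹)) ≠ 0 := fun h0 => by
    simpa using congrArg (PowerSeries.coeff 0) h0
  funext i
  refine (SeparatingDual.eq_iff_forall_dual_eq (R := ℝ)).2 fun ℓ => ?_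
  have hv := mk_wordEval_texpProd_replicate v e ℓ hv
  rw [h, mk_wordEval_texpProd_replicate v' e ℓ hv'] at hv
  exact congrFun (eq_of_sum_exp_pow_eq (mul_right_cancel₀ hne hv.symm)) i

theorem incr_injective {E : Type u} [NormedAddCommGroup E] {T : ℕ} :
    Function.Injective (incr : (Fin (T + 1) → E) → Fin (T + 1) → Aug E) := by
  intro x y h
  have hsnd (t) : (incr x t).snd = (incr y t).snd := by rw [h]
  funext t
  induction t using Fin.induction with
  | zero => exact hsnd 0
  | succ t ih =>
    have hdiff : x t.succ - x t.castSucc = y t.succ - y t.castSucc := hsnd t.succ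
    rwa [ih, sub_left_inj] at hdiff

theorem wordEval_sigSeries_injective {T : ℕ} :
    Function.Injective fun x : Fin (T + 1) → W => wordEval (sigSeries x) := fun x y h =>
  incr_injective <| eq_of_wordEval_texpProd_eq (WithLp.fstL 1 ℝ ℝ W) (fun _ => rfl) (fun _ => rfl)
    (by simpa only [sigSeries_eq_texpProd] using h)

end TensorWords

/-! ### Continuity of the signature -/

section Continuity

variable {W : Type u} [NormedAddCommGroup W] [NormedSpace ℝ W]

/-- The identity from the algebraic to the normed tensor power. -/
def TPow.of (α : AdmissibleNorm W) (m : ℕ) : ⨂[ℝ]^m W ≃ₗ[ℝ] TPow α m :=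
  LinearEquiv.refl ℝ (⨂[ℝ]^m W)

theorem TPow.norm_of (α : AdmissibleNorm W) {m : ℕ} (t : ⨂[ℝ]^m W) :
    ‖TPow.of α m t‖ = α.nrm m t := rfl

/-- The tensor product as a bilinear map of normed tensor powers. The total degree `m` is a free
parameter, to absorb the casts in `tmul`. -/
def TPow.mulₗ (α : AdmissibleNorm W) {i j m : ℕ} (h : i + j = m) :
    TPow α i →ₗ[ℝ] TPow α j →ₗ[ℝ] TPow α m :=
  ((tpMulₗ W i j).compr₂
    ((TPow.of α m).toLinearMap.comp (TensorPower.cast ℝ W h).toLinearMap)).compl₁₂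
    (TPow.of α i).symm.toLinearMap (TPow.of α j).symm.toLinearMap

theorem TPow.mulₗ_of (α : AdmissibleNorm W) {i j m : ℕ} (h : i + j = m) (s : ⨂[ℝ]^i W)
    (t : ⨂[ℝ]^j W) : TPow.mulₗ α h (TPow.of α i s) (TPow.of α j t) =
      TPow.of α m (TensorPower.cast ℝ W h (tpMul s t)) := rfl

theorem TPow.norm_mulₗ_le (α : AdmissibleNorm W) {i j m : ℕ} (h : i + j = m) (a : TPow α i)
    (b : TPow α j) : ‖TPow.mulₗ α h a b‖ ≤ 1 * ‖a‖ * ‖b‖ := by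
  obtain ⟨s, rfl⟩ := (TPow.of α i).surjective a
  obtain ⟨t, rfl⟩ := (TPow.of α j).surjective b
  rw [TPow.mulₗ_of, TPow.norm_of, TPow.norm_of, TPow.norm_of, α.nrm_cast, one_mul]
  exact α.mul_le _ _ s t

theorem TPow.continuous_mulₗ (α : AdmissibleNorm W) {i j m : ℕ} (h : i + j = m) :
    Continuous fun p : TPow α i × TPow α j => TPow.mulₗ α h p.1 p.2 :=
  (LinearMap.mkContinuous₂ (TPow.mulₗ α h) 1 (TPow.norm_mulₗ_le α h)).continuous₂

section Parameter

variable {X : Type*} [TopologicalSpace X]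

theorem continuous_texp (α : AdmissibleNorm W) {v : X → W} (hv : Continuous v) (m : ℕ) :
    Continuous fun x => TPow.of α m (texp (v x) m) := by
  have htprod : Continuous ((TPow.of α m).toLinearMap.compMultilinearMap
      (PiTensorProduct.tprod ℝ (s := fun _ : Fin m => W))) :=
    MultilinearMap.continuous_of_bound _ 1 fun v => by
      rw [one_mul]
      exact α.tprod_le m v
  exact (htprod.comp (continuous_pi fun _ : Fin m => hv)).const_smul ((m.factorial : ℝ)⁻¹)

theorem continuous_tmul (α : AdmissibleNorm W) {s t : X → TSeries W}
    (hs : ∀ m, Continuous fun x => TPow.of α m (s x m))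
    (ht : ∀ m, Continuous fun x => TPow.of α m (t x m)) (m : ℕ) :
    Continuous fun x => TPow.of α m (tmul (s x) (t x) m) := by
  simp only [tmul, map_sum, ← TPow.mulₗ_of]
  exact continuous_finsetSum _ fun i _ => (TPow.continuous_mulₗ α _).comp₂ (hs i) (ht (m - i))

theorem continuous_texpProd (α : AdmissibleNorm W) {n : ℕ} {v : X → Fin n → W}
    (hv : ∀ i, Continuous fun x => v x i) (m : ℕ) :
    Continuous fun x => TPow.of α m (texpProd (v x) m) := by
  induction n generalizing m with
  | zero =>
    simp only [texpProd_zero]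
    exact continuous_const
  | succ n ih =>
    simp only [texpProd_succ]
    exact continuous_tmul α (continuous_texp α (hv 0)) (ih fun i => hv i.succ) m

theorem continuous_lp_one_of_dominated {G : ℕ → Type*} [∀ m, NormedAddCommGroup (G m)]
    {f : X → lp G 1} (hf : ∀ m, Continuous fun x => f x m)
    (hb : ∀ x₀, ∃ b : ℕ → ℝ, Summable b ∧ ∀ᶠ x in 𝓝 x₀, ∀ m, ‖f x m‖ ≤ b m) :
    Continuous f := by
  refine continuous_iff_continuousAt.2 fun x₀ => ?_
  obtain ⟨b, hsum, hbound⟩ := hb x₀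
  have hnorm (x) : ‖f x - f x₀‖ = ∑' m, ‖f x m - f x₀ m‖ := by
    rw [lp.norm_eq_tsum_rpow (by simp)]
    simp
  have hcoord (m) : Tendsto (fun x => ‖f x m - f x₀ m‖) (𝓝 x₀) (𝓝 0) :=
    tendsto_iff_norm_sub_tendsto_zero.1 ((hf m).tendsto x₀)
  rw [ContinuousAt, tendsto_iff_norm_sub_tendsto_zero]
  simp only [hnorm]
  rw [← tsum_zero (α := ℝ) (β := ℕ)]
  refine tendsto_tsum_of_dominated_convergence (hsum.add hsum) hcoord ?_
  filter_upwards [hbound] with x hx m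
  rw [norm_norm]
  exact (norm_sub_le _ _).trans (add_le_add (hx m) (hbound.self_of_nhds m))

end Parameter

theorem nrm_texp_le (α : AdmissibleNorm W) (v : W) (m : ℕ) :
    α.nrm m (texp v m) ≤ ‖v‖ ^ m / m.factorial := by
  rw [texp, map_smul_eq_mul, Real.norm_of_nonneg (by positivity), div_eq_inv_mul]
  exact mul_le_mul_of_nonneg_left ((α.tprod_le m _).trans_eq (by simp)) (by positivity)

-- The binomial theorem: the bounds are the coefficients of `exp (a z)` and `exp (b z)`.
theorem nrm_tmul_le (α : AdmissibleNorm W) {s t : TSeries W} {a b : ℝ} (ha : 0 ≤ a)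
    (hs : ∀ m, α.nrm m (s m) ≤ a ^ m / m.factorial)
    (ht : ∀ m, α.nrm m (t m) ≤ b ^ m / m.factorial) (m : ℕ) :
    α.nrm m (tmul s t m) ≤ (a + b) ^ m / m.factorial := by
  refine (Finset.le_sum_of_subadditive (α.nrm m) (map_zero _).le (map_add_le_add _) _ _).trans ?_
  rw [add_pow, Finset.sum_div, Finset.sum_range]
  refine Finset.sum_le_sum fun i _ => ?_
  have hi : (i : ℕ) ≤ m := Nat.le_of_lt_succ i.2
  have hfactorial : (m.factorial : ℝ) ≠ 0 := Nat.cast_ne_zero.2 (Nat.factorial_ne_zero _)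
  rw [α.nrm_cast, Nat.cast_choose ℝ hi]
  calc α.nrm _ (tpMul (s i) (t (m - i)))
      ≤ α.nrm i (s i) * α.nrm (m - i) (t (m - i)) := α.mul_le _ _ _ _
    _ ≤ a ^ (i : ℕ) / (i : ℕ).factorial * (b ^ (m - i) / (m - i).factorial) :=
        mul_le_mul (hs i) (ht (m - i)) (apply_nonneg _ _) (by positivity)
    _ = _ := by field_simp

theorem nrm_texpProd_le (α : AdmissibleNorm W) {n : ℕ} (v : Fin n → W) (m : ℕ) :
    α.nrm m (texpProd v m) ≤ (∑ i, ‖v i‖) ^ m / m.factorial := by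
  induction n generalizing m with
  | zero =>
    rw [texpProd_zero]
    simpa using nrm_texp_le α (0 : W) m
  | succ n ih =>
    rw [texpProd_succ, Fin.sum_univ_succ]
    exact nrm_tmul_le α (norm_nonneg _) (nrm_texp_le α (v 0)) (ih fun i => v i.succ) m

theorem continuous_incr {E : Type u} [NormedAddCommGroup E] {T : ℕ} (t : Fin (T + 1)) :
    Continuous fun x : Fin (T + 1) → E => incr x t := by
  refine (WithLp.prod_continuous_toLp 1 ℝ E).comp (continuous_const.prodMk ?_)
  induction t using Fin.cases with
  | zero => exact continuous_apply 0
  | succ s => exact (continuous_apply s.succ).sub (continuous_apply s.castSucc)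

theorem continuous_signature {T : ℕ} (α : AdmissibleNorm (Aug W)) :
    Continuous (signature (T := T) (W := W) α) := by
  refine continuous_lp_one_of_dominated (fun m => ?_) fun x₀ => ?_
  · exact (UniformSpace.Completion.continuous_coe (TPow α m)).comp
      (continuous_texpProd α continuous_incr m)
  · have hsum : Continuous fun x : Fin (T + 1) → W => ∑ t, ‖incr x t‖ :=
      continuous_finsetSum _ fun t _ => (continuous_incr t).norm
    refine ⟨fun m => (∑ t, ‖incr x₀ t‖ + 1) ^ m / m.factorial,
      Real.summable_pow_div_factorial _, ?_⟩
    filter_upwards [(hsum.tendsto x₀).eventually (gt_mem_nhds (lt_add_one _))] with x hx m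
    calc ‖signature α x m‖ = α.nrm m (texpProd (incr x) m) := TPow.norm_toCompletion α m _
      _ ≤ (∑ t, ‖incr x t‖) ^ m / m.factorial := nrm_texpProd_le α (incr x) m
      _ ≤ (∑ t, ‖incr x₀ t‖ + 1) ^ m / m.factorial := by gcongr

theorem tprod_eq_tpOne (a : Fin 0 → W) : PiTensorProduct.tprod ℝ a = tpOne W :=
  congrArg (PiTensorProduct.tprod ℝ) (Subsingleton.elim _ _)

theorem texp_apply_zero (v : W) : texp v 0 = tpOne W := by
  simp [texp, tprod_eq_tpOne]

theorem texpProd_apply_zero {n : ℕ} (v : Fin n → W) : texpProd v 0 = tpOne W := by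
  induction n with
  | zero => rw [texpProd_zero, texp_apply_zero]
  | succ n ih =>
    rw [texpProd_succ, tmul, Fin.sum_univ_one]
    simp only [Fin.val_zero, Nat.sub_zero]
    rw [ih fun i => v i.succ, texp_apply_zero, ← tprod_eq_tpOne Fin.elim0, tpMul_tprod,
      TensorPower.cast_tprod, tprod_eq_tpOne, tprod_eq_tpOne]

theorem signature_mem_unital {T : ℕ} (α : AdmissibleNorm (Aug W)) (x : Fin (T + 1) → W) :
    signature α x ∈ unital α :=
  congrArg (TPow.toCompletion α 0) (texpProd_apply_zero (incr x))

end Continuity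

/-! ### Characteristic features -/

section Characteristic

variable {W : Type u} [NormedAddCommGroup W] [NormedSpace ℝ W] {α : AdmissibleNorm W}

/-- `tensorForm` as a continuous functional on the normed tensor power. -/
def tensorFormCLM (α : AdmissibleNorm W) {n : ℕ} (ℓ : Fin n → (W →L[ℝ] ℝ)) : TPow α n →L[ℝ] ℝ :=
  LinearMap.mkContinuous ((tensorForm ℓ).comp (TPow.of α n).symm.toLinearMap) (∏ i, ‖ℓ i‖)
    fun t => α.dual_le n ℓ t

/-- The continuous extension of `wordEval` to the completed tensor algebra. -/
def wordCLM (α : AdmissibleNorm W) (w : List (W →L[ℝ] ℝ)) : TAlg α →L[ℝ] ℝ :=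
  ((tensorFormCLM α w.get).extend (UniformSpace.Completion.toComplL (𝕜 := ℝ))).comp
    (lp.evalCLM ℝ (fun m : ℕ => UniformSpace.Completion (TPow α m)) 1 w.length)

theorem wordCLM_of_eq_smul {w : List (W →L[ℝ] ℝ)} {t : TAlg α} {s : TSeries W} {c : ℝ}
    (h : t w.length = c • TPow.toCompletion α w.length (s w.length)) :
    wordCLM α w t = c * wordEval s w := by
  change (tensorFormCLM α w.get).extend (UniformSpace.Completion.toComplL (𝕜 := ℝ)) (t w.length) = _
  rw [h, map_smul, smul_eq_mul]
  congr 1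
  exact ContinuousLinearMap.extend_eq (tensorFormCLM α w.get)
    (e := UniformSpace.Completion.toComplL (𝕜 := ℝ)) UniformSpace.Completion.denseRange_coe
    (UniformSpace.Completion.isUniformInducing_coe _) (s w.length)

/-- Continuous feature maps with group-like values whose coordinates separate points. If bounded,
their expectations determine probability measures, see `injective_integral_of_isCharacteristic`. -/
structure IsCharacteristic {X : Type*} [TopologicalSpace X] (G : X → TAlg α) : Prop where
  continuous : Continuous G
  isGroupLike : ∀ x, IsGroupLike fun w => wordCLM α w (G x)
  eq_of_forall_wordCLM_eq : ∀ x y, (∀ w, wordCLM α w (G x) = wordCLM α w (G y)) → x = y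

theorem IsCharacteristic.comp {X Y : Type*} [TopologicalSpace X] [TopologicalSpace Y]
    {G : Y → TAlg α} (hG : IsCharacteristic G) {f : X → Y} (hf : Continuous f)
    (hinj : Function.Injective f) : IsCharacteristic fun x => G (f x) where
  continuous := hG.continuous.comp hf
  isGroupLike x := hG.isGroupLike (f x)
  eq_of_forall_wordCLM_eq x y h := hinj (hG.eq_of_forall_wordCLM_eq (f x) (f y) h)

end Characteristic

section Signature

variable {W : Type u} [NormedAddCommGroup W] [NormedSpace ℝ W] {T : ℕ} {α : AdmissibleNorm (Aug W)}

theorem wordCLM_signature (x : Fin (T + 1) → W) (w : List (Aug W →L[ℝ] ℝ)) :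
    wordCLM α w (signature α x) = wordEval (sigSeries x) w := by
  rw [wordCLM_of_eq_smul (c := 1) (s := sigSeries x) (one_smul ℝ _).symm, one_mul]

theorem wordCLM_normalization_signature (Λ : TensorNormalization α) (x : Fin (T + 1) → W)
    (w : List (Aug W →L[ℝ] ℝ)) : wordCLM α w (Λ.toFun (signature α x)) =
      Λ.lam (signature α x) ^ w.length * wordEval (sigSeries x) w :=
  wordCLM_of_eq_smul (Λ.apply_eq _ (signature_mem_unital α x) w.length)

theorem isGroupLike_wordEval_sigSeries (x : Fin (T + 1) → W) :
    IsGroupLike (wordEval (sigSeries x)) := isGroupLike_wordEval_texpProd (incr x)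

theorem isCharacteristic_signature : IsCharacteristic (signature α (T := T)) where
  continuous := continuous_signature α
  isGroupLike x := by
    simp only [wordCLM_signature]
    exact isGroupLike_wordEval_sigSeries x
  eq_of_forall_wordCLM_eq x y h := by
    simp only [wordCLM_signature] at h
    exact wordEval_sigSeries_injective (funext h)

theorem wordEval_sigSeries_fst (x : Fin (T + 1) → W) :
    wordEval (sigSeries x) [WithLp.fstL 1 ℝ ℝ W] = T + 1 := by
  simpa [sigSeries_eq_texpProd, PowerSeries.coeff_zero_eq_constantCoeff_apply, incr] using
    congrArg (PowerSeries.coeff 0)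
      (mk_wordEval_texpProd_replicate (incr x) (WithLp.fstL 1 ℝ ℝ W) (WithLp.fstL 1 ℝ ℝ W)
        fun _ => rfl)

-- The time component of the first level of the signature is always `T + 1`, so the scaling factor
-- can be recovered from the normalized signature.
theorem isCharacteristic_normalization_signature (Λ : TensorNormalization α) :
    IsCharacteristic fun x : Fin (T + 1) → W => Λ.toFun (signature α x) where
  continuous := Λ.continuousOn.comp_continuous (continuous_signature α) (signature_mem_unital α)
  isGroupLike x := by
    simp only [wordCLM_normalization_signature]
    exact (isGroupLike_wordEval_sigSeries x).scale _
  eq_of_forall_wordCLM_eq x y h := by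
    simp only [wordCLM_normalization_signature] at h
    have hlam : Λ.lam (signature α x) = Λ.lam (signature α y) := by
      have hfst := h [WithLp.fstL 1 ℝ ℝ W]
      rw [wordEval_sigSeries_fst, wordEval_sigSeries_fst, List.length_singleton, pow_one,
        pow_one] at hfst
      exact mul_right_cancel₀ (Nat.cast_add_one_ne_zero T) hfst
    have hpos : 0 < Λ.lam (signature α y) := Λ.lam_pos _ (signature_mem_unital α y)
    rw [hlam] at h
    exact wordEval_sigSeries_injective
      (funext fun w => mul_left_cancel₀ (pow_pos hpos w.length).ne' (h w))

end Signature

/-! ### Expected features determine measures -/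

section WordFeatures

variable {W : Type u} [NormedAddCommGroup W] [NormedSpace ℝ W] {α : AdmissibleNorm W} {X : Type*}
  [TopologicalSpace X]

/-- The coordinate of a bounded feature map at a word of functionals. -/
def wordFeature (G : X →ᵇ TAlg α) (w : List (W →L[ℝ] ℝ)) : X →ᵇ ℝ :=
  (wordCLM α w).compLeftContinuousBounded X G

theorem wordFeature_mul {G : X →ᵇ TAlg α} (hG : IsCharacteristic G) (u v : List (W →L[ℝ] ℝ)) :
    wordFeature G u * wordFeature G v = ((shuffles u v).map (wordFeature G)).sum := by
  ext x
  have heval := map_list_sum (BoundedContinuousFunction.evalCLM ℝ x)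
    ((shuffles u v).map (wordFeature G))
  rw [List.map_map] at heval
  exact ((hG.isGroupLike x).mul u v).trans heval.symm

/-- The linear span of the coordinates of `G`, which the shuffle identity makes an algebra. -/
def wordFeatureAlgebra {G : X →ᵇ TAlg α} (hG : IsCharacteristic G) :
    StarSubalgebra ℝ (X →ᵇ ℝ) where
  toSubalgebra := (Submodule.span ℝ (range (wordFeature G))).toSubalgebra
    (Submodule.subset_span ⟨[], by ext x; exact (hG.isGroupLike x).nil⟩) fun φ ψ hφ hψ => by
      have hmul := Submodule.mul_mem_mul hφ hψ
      rw [Submodule.span_mul_span] at hmul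
      refine Submodule.span_le.2 ?_ hmul
      rintro _ ⟨_, ⟨u, rfl⟩, _, ⟨v, rfl⟩, rfl⟩
      change wordFeature G u * wordFeature G v ∈ Submodule.span ℝ (range (wordFeature G))
      rw [wordFeature_mul hG]
      refine list_sum_mem fun φ hφ => ?_
      obtain ⟨w, -, rfl⟩ := List.mem_map.1 hφ
      exact Submodule.subset_span ⟨w, rfl⟩
  star_mem' {φ} hφ := by
    rwa [show star φ = φ by ext x; simp]

theorem wordFeature_mem_wordFeatureAlgebra {G : X →ᵇ TAlg α} (hG : IsCharacteristic G)
    (w : List (W →L[ℝ] ℝ)) : wordFeature G w ∈ wordFeatureAlgebra hG :=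
  Submodule.subset_span ⟨w, rfl⟩

theorem integral_eq_of_mem_wordFeatureAlgebra [MeasurableSpace X] [OpensMeasurableSpace X]
    [TopologicalSpace.PseudoMetrizableSpace X] [SecondCountableTopology X] {G : X →ᵇ TAlg α}
    (hG : IsCharacteristic G) {μ ν : Measure X} [IsFiniteMeasure μ] [IsFiniteMeasure ν]
    (h : ∫ x, G x ∂μ = ∫ x, G x ∂ν) {φ : X →ᵇ ℝ} (hφ : φ ∈ wordFeatureAlgebra hG) :
    ∫ x, φ x ∂μ = ∫ x, φ x ∂ν := by
  replace hφ : φ ∈ Submodule.span ℝ (range (wordFeature G)) := hφ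
  induction hφ using Submodule.span_induction with
  | mem φ hφ =>
    obtain ⟨w, rfl⟩ := hφ
    have hint (ρ : Measure X) [IsFiniteMeasure ρ] : Integrable G ρ :=
      Integrable.of_bound G.continuous.aestronglyMeasurable ‖G‖
        (ae_of_all _ G.norm_coe_le_norm)
    exact ((wordCLM α w).integral_comp_comm (hint μ)).trans
      ((congrArg _ h).trans ((wordCLM α w).integral_comp_comm (hint ν)).symm)
  | zero => simp
  | add φ ψ _ _ hφ hψ =>
    simp only [BoundedContinuousFunction.add_apply]
    rw [integral_add (φ.integrable _) (ψ.integrable _),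
      integral_add (φ.integrable _) (ψ.integrable _), hφ, hψ]
  | smul c φ _ hφ =>
    simp only [BoundedContinuousFunction.smul_apply, integral_smul, hφ]

theorem injective_integral_of_isCharacteristic {A : BorelSp.{u}} [PolishSpace A.carrier]
    {G : A.carrier →ᵇ TAlg α} (hG : IsCharacteristic G) :
    Function.Injective fun μ : A.prob.carrier => ∫ x, G x ∂BorelSp.measureOf μ := by
  intro μ ν hμν
  refine BorelSp.eq_of_forall_integral_eq (S := wordFeatureAlgebra hG) (fun x y hxy => ?_)
    fun φ hφ => integral_eq_of_mem_wordFeatureAlgebra hG hμν hφ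
  by_contra! hcon
  exact hxy (hG.eq_of_forall_wordCLM_eq x y fun w =>
    hcon _ (wordFeature_mem_wordFeatureAlgebra hG w))

end WordFeatures

/-! ### Expected signatures of higher rank -/

section ExpSig

variable {α : TensorNorms.{u}} {T : ℕ} {F : PathFeature α T}

theorem isCharacteristic_comp_path {A : BorelSp.{u}} {W : Type u} [NormedAddCommGroup W]
    [NormedSpace ℝ W] (hF : IsCharacteristic (F W)) {e : A.carrier → W} (he : Continuous e)
    (hinj : Function.Injective e) :
    IsCharacteristic fun x : (A.path T).carrier => F W fun t => e (x t) :=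
  hF.comp (X := (A.path T).carrier) (f := fun x t => e (x t))
    (continuous_pi fun t => he.comp (BorelSp.continuous_eval t))
    fun _ _ h => funext fun t => hinj (congrFun h t)

theorem continuous_injective_integral_of_isCharacteristic {A : BorelSp.{u}} [PolishSpace A.carrier]
    {W : Type u} [NormedAddCommGroup W] [NormedSpace ℝ W] {α : AdmissibleNorm W}
    {G : A.carrier → TAlg α} (hG : IsCharacteristic G) (hb : ∃ C, ∀ x, ‖G x‖ ≤ C) :
    (Continuous fun μ : A.prob.carrier => ∫ x, G x ∂BorelSp.measureOf μ) ∧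
      Function.Injective fun μ : A.prob.carrier => ∫ x, G x ∂BorelSp.measureOf μ := by
  obtain ⟨C, hC⟩ := hb
  let G' : A.carrier →ᵇ TAlg α := .ofNormedAddCommGroup G hG.continuous C hC
  exact ⟨continuous_integral_boundedContinuousFunction G',
    injective_integral_of_isCharacteristic (G := G') hG⟩

variable {U : Type u} [TopologicalSpace U] [MeasurableSpace U] [BorelSpace U] [PolishSpace U]
  {V : Type u} [NormedAddCommGroup V] [NormedSpace ℝ V] {ι : U → V}

theorem continuous_injective_expSig
    (hF : ∀ (W : Type u) [NormedAddCommGroup W] [NormedSpace ℝ W], IsCharacteristic (F W))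
    (hb : CompactSpace U ∨ ∀ (W : Type u) [NormedAddCommGroup W] [NormedSpace ℝ W],
      ∃ C, ∀ x, ‖F W x‖ ≤ C)
    (hι : Continuous ι) (hinj : Function.Injective ι) :
    ∀ k, Continuous (expSig F ι k) ∧ Function.Injective (expSig F ι k)
  | 0 => ⟨hι, hinj⟩
  | k + 1 => by
    have ih := continuous_injective_expSig hF hb hι hinj k
    have hG := isCharacteristic_comp_path (hF _) ih.1 ih.2
    refine continuous_injective_integral_of_isCharacteristic hG ?_
    rcases hb with hU | hb
    · have : CompactSpace (BorelSp.of U).carrier := hU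
      have := compactSpace_probRank (T := T) (A := BorelSp.of U) k
      obtain ⟨C, hC⟩ := isCompact_univ.exists_bound_of_continuousOn hG.continuous.continuousOn
      exact ⟨C, fun x => hC x (mem_univ x)⟩
    · obtain ⟨C, hC⟩ := hb (TRank α V k).carrier
      exact ⟨C, fun x => hC _⟩

/-! ### Comparison of the topologies -/

theorem forall_expect_eq_iff_Phi_eq {r : ℕ} (hinj : Function.Injective (expSig F ι (r + 1)))
    (X Y : AdaptedProcess.{u, w} T U) :
    (∀ f ∈ AF T U r, f.expect X = f.expect Y) ↔ Phi F ι r X = Phi F ι r Y :=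
  (forall_expect_eq_iff r X Y).trans hinj.eq_iff.symm

theorem induced_tau_eq_of_isCompact {r : ℕ} (hcont : Continuous (expSig F ι (r + 1)))
    (hinj : Function.Injective (expSig F ι (r + 1))) {S : Type*} (j : S → AdaptedProcess.{u, w} T U)
    {C : Set (probRank T (BorelSp.of U) (r + 1)).carrier} (hC : IsCompact C)
    (hj : ∀ s, (j s).lawPrediction r ∈ C) :
    (tau T U r).induced j = TopologicalSpace.induced (fun s => Phi F ι r (j s)) inferInstance ∧
      (tau T U r).induced j = semimetricTopology (fun s s' => sigDist F ι r (j s) (j s')) ∧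
      (tau T U r).induced j = (tauHat T U r).induced j := by
  let L : S → (probRank T (BorelSp.of U) (r + 1)).carrier := fun s => (j s).lawPrediction r
  have htau : (tau T U r).induced j = TopologicalSpace.induced L inferInstance := by
    rw [tau_eq_induced, induced_compose]
    exact induced_comp_eq_of_isCompact (L := L) (continuous_representableIntegrals.{u, w} r)
      (injective_representableIntegrals.{u, w} r) hC hj
  have hPhi : TopologicalSpace.induced (fun s => Phi F ι r (j s)) inferInstance =
      TopologicalSpace.induced L inferInstance :=
    induced_comp_eq_of_isCompact hcont hinj hC hj
  have htauHat : (tauHat T U r).induced j = TopologicalSpace.induced L inferInstance :=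
    induced_compose
  exact ⟨htau.trans hPhi.symm, (htau.trans hPhi.symm).trans (semimetricTopology_norm_sub _).symm,
    htau.trans htauHat.symm⟩

theorem tau_eq_of_compactSpace [CompactSpace U] {r : ℕ}
    (hcont : Continuous (expSig F ι (r + 1))) (hinj : Function.Injective (expSig F ι (r + 1))) :
    tau.{u, w} T U r = TopologicalSpace.induced (fun X => Phi F ι r X) inferInstance ∧
      tau.{u, w} T U r = semimetricTopology (fun X Y => sigDist F ι r X Y) ∧
      tau.{u, w} T U r = tauHat T U r := by
  have : CompactSpace (BorelSp.of U).carrier := ‹CompactSpace U›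
  have := compactSpace_probRank (T := T) (A := BorelSp.of U) (r + 1)
  simpa only [induced_id, id_eq] using induced_tau_eq_of_isCompact hcont hinj
    (id : AdaptedProcess.{u, w} T U → _) isCompact_univ fun _ => mem_univ _

theorem isCompact_image_lawPrediction {r : ℕ} {𝒦 : Set (AdaptedProcess.{u, w} T U)}
    (h𝒦 : @IsCompact _ (tauHat T U r) 𝒦) : IsCompact ((fun X => X.lawPrediction r) '' 𝒦) :=
  let := tauHat.{u, w} T U r
  h𝒦.image continuous_induced_dom

end ExpSig

theorem isCharacteristic_robustSig {α : TensorNorms.{u}} (Λ : TensorNormalizations α) (T : ℕ)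
    (W : Type u) [NormedAddCommGroup W] [NormedSpace ℝ W] : IsCharacteristic (robustSig α Λ T W) :=
  isCharacteristic_normalization_signature (Λ (Aug W))

theorem exists_norm_robustSig_le {α : TensorNorms.{u}} (Λ : TensorNormalizations α) (T : ℕ)
    (W : Type u) [NormedAddCommGroup W] [NormedSpace ℝ W] : ∃ C, ∀ x, ‖robustSig α Λ T W x‖ ≤ C :=
  (Λ (Aug W)).bounded.imp fun _ hC _ => hC _ (signature_mem_unital _ _)

end AdaptedSig

end

open AdaptedSig in
theorem theorem4p8 {V : Type u} [NormedAddCommGroup V] [NormedSpace ℝ V] [CompleteSpace V]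
    [SecondCountableTopology V] [MeasurableSpace V] [BorelSpace V] (T r : ℕ)
    (α : TensorNorms.{u}) (Λ : TensorNormalizations α) :
    -- equality of the adapted distributions up to rank `r` is equality of the images under `Φ_r`
    (∀ X Y : AdaptedProcess.{u, w} T V,
      (∀ f ∈ AF T V r, f.expect X = f.expect Y) ↔
        Phi (robustSig α Λ T) (id : V → V) r X = Phi (robustSig α Λ T) (id : V → V) r Y) ∧
    -- on compact sets of processes `Φ_r` induces and `d_r` metrizes `τ_r`
    (∀ 𝒦 : Set (AdaptedProcess.{u, w} T V), @IsCompact _ (tauHat T V r) 𝒦 →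
      (tau T V r).induced ((↑) : 𝒦 → AdaptedProcess.{u, w} T V) =
        TopologicalSpace.induced
          (fun X : 𝒦 => Phi (robustSig α Λ T) (id : V → V) r X.1) inferInstance ∧
      (tau T V r).induced ((↑) : 𝒦 → AdaptedProcess.{u, w} T V) =
        semimetricTopology
          (fun X Y : 𝒦 => sigDist (robustSig α Λ T) (id : V → V) r X.1 Y.1) ∧
      (tau T V r).induced ((↑) : 𝒦 → AdaptedProcess.{u, w} T V) =
        (tauHat T V r).induced ((↑) : 𝒦 → AdaptedProcess.{u, w} T V)) ∧
    -- compact state spaces: no localization, with the robust and with the classical signature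
    (∀ K : Set V, IsCompact K →
      ∀ F : PathFeature α T, F = robustSig α Λ T ∨ F = classicalSig α T →
        (∀ X Y : AdaptedProcess.{u, w} T K,
          (∀ f ∈ AF T K r, f.expect X = f.expect Y) ↔
            Phi F ((↑) : K → V) r X = Phi F ((↑) : K → V) r Y) ∧
        tau.{u, w} T K r =
          TopologicalSpace.induced (fun X => Phi F ((↑) : K → V) r X) inferInstance ∧
        tau.{u, w} T K r =
          semimetricTopology (fun X Y => sigDist F ((↑) : K → V) r X Y) ∧
        tau.{u, w} T K r = tauHat T K r) := by
  obtain ⟨hcont, hinj⟩ := continuous_injective_expSig (isCharacteristic_robustSig Λ T)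
    (.inr (exists_norm_robustSig_le Λ T)) (continuous_id (X := V)) Function.injective_id (r + 1)
  refine ⟨forall_expect_eq_iff_Phi_eq hinj, fun 𝒦 h𝒦 => ?_, fun K hK F hF => ?_⟩
  · exact induced_tau_eq_of_isCompact hcont hinj ((↑) : 𝒦 → AdaptedProcess.{u, w} T V)
      (isCompact_image_lawPrediction h𝒦) fun X => ⟨X.1, X.2, rfl⟩
  · have : CompactSpace K := isCompact_iff_compactSpace.1 hK
    have hchar (W : Type u) [NormedAddCommGroup W] [NormedSpace ℝ W] :
        IsCharacteristic (F W) := by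
      rcases hF with rfl | rfl
      · exact isCharacteristic_robustSig Λ T W
      · exact isCharacteristic_signature
    obtain ⟨hcontK, hinjK⟩ := continuous_injective_expSig hchar (.inl this)
      (continuous_subtype_val (p := (· ∈ K))) Subtype.val_injective (r + 1)
    exact ⟨forall_expect_eq_iff_Phi_eq hinjK, tau_eq_of_compactSpace hcontK hinjK⟩
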